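/- For $n\ge 0$ let $\mathfrak S_n$ be the set of permutations $\pi=\pi_1\pi_2\cdots\pi_n$ of $\{1,\dots,n\}$. For $\sigma\in\mathfrak S_m$ let $\mathrm{occ}_\sigma(\pi)$ be the number of $j$ with $1\le j\le n-m+1$ such that $\pi_j\pi_{j+1}\cdots\pi_{j+m-1}$ standardizes to $\sigma$ (that is, becomes $\sigma$ when its smallest letter is replaced by $1$, the second smallest by $2$, and so on). Let $\mathrm{pk}(\pi)$ be the number of $j\in\{2,\dots,n-1\}$ with $\pi_{j-1}<\pi_j>\pi_{j+1}$, and let $\mathrm{ipk}(\pi)=\mathrm{pk}(\pi^{-1})$. For $n\ge 1$ put $$P^{\mathrm{ipk}}_{\sigma,n}(s,t)=\sum_{\pi\in\mathfrak S_n}s^{\mathrm{occ}_\sigma(\pi)}t^{\mathrm{ipk}(\pi)+1},\qquad P^{\mathrm{ipk}}_{\sigma,n}(t)=P^{\mathrm{ipk}}_{\sigma,n}(0,t)$$ (so that $P^{\mathrm{ipk}}_{\sigma,n}(t)$ counts the permutations with no occurrence of $\sigma$). For formal power series in $t$ whose coefficients $a_n,b_n$ are formal power series in the remaining variables, the Hadamard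 product in $t$ is $\left(\sum_n a_nt^n\right)*\left(\sum_n b_nt^n\right)=\sum_n a_nb_nt^n$. Write $f^{*\langle n\rangle}$ for the $n$-fold Hadamard product of $f$ with itself, where $f^{*\langle 0\rangle}=1/(1-t)$ is the identity for $*$. All other products and quotients are the ordinary ones. **Theorem.** Let $m\ge 5$ and $2\le a\le m-2$, let $\sigma=12\cdots(a-1)(a+1)a(a+2)(a+3)\cdots m\in\mathfrak S_m$, and let $i=\min(a,m-a)$. Put $u=\dfrac{4t}{(1+t)^2}$ and $z=\dfrac{(1+t)x}{1-t}$. Then (a) in $\mathbb Q[[s,t,x]]$, $$\frac1{1-t}+\frac{1+t}{2(1-t)}\sum_{n=1}^\infty P^{\mathrm{ipk}}_{\sigma,n}(s,u)\,z^n=\sum_{n=0}^\infty\left(\frac{2tx}{(1-t)^2}+\frac{(1+t)(s-1)u^2z^m}{2(1-t)\left(1-(s-1)u\sum_{l=1}^{i}z^{m-l}\right)}\right)^{*\langle n\rangle};$$ (b) in $\mathbb Q[[t,x]]$, $$\frac1{1-t}+\frac{1+t}{2(1-t)}\sum_{n=1}^\infty P^{\mathrm{ipk}}_{\sigma,n}(u)\,z^n=\sum_{n=0}^\infty\left(\frac{2tx}{(1-t)^2}-\frac{(1+t)u^2z^m}{2(1-t)\left(1+u\sum_{l=1}^{i}z^{m-l}\right)}\right)^{*\langle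 n\rangle}.$$ In all four infinite sums each monomial in $t$ and $x$ has a nonzero coefficient in only finitely many terms, so that the sums are well defined coefficientwise. -/

import Mathlib

open scoped Ring

/-! ### Permutations, consecutive patterns, inverse peaks

A permutation of length `n` is an element of `Equiv.Perm (Fin n)`; positions and letters are
numbered from `0` instead of from `1`. -/

/-- Standardization of a word with distinct letters: the smallest letter is replaced by `0`, the
second smallest by `1`, and so on; that is, each letter is replaced by the number of letters of the
word that are smaller. -/
def stdWord {m n : ℕ} (w : Fin m → Fin n) : Fin m → ℕ :=
  fun j => (Finset.univ.filter fun k => w k < w j).card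

/-- `occ σ π`: the number of starting positions `i` such that the word of `m` consecutive letters
of `π` starting at position `i` standardizes to `σ`. -/
def occ {m n : ℕ} (σ : Equiv.Perm (Fin m)) (π : Equiv.Perm (Fin n)) : ℕ :=
  ((Finset.range (n + 1)).filter fun i =>
    ∃ h : i + m ≤ n,
      stdWord (fun j : Fin m => π ⟨i + j, by omega⟩) = fun j => (σ j : ℕ)).card

/-- The peak number: the number of interior positions whose letter is larger than both of its
neighbours. -/
def peakNumber {n : ℕ} (π : Equiv.Perm (Fin n)) : ℕ :=
  (Finset.univ.filter fun i : Fin n =>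
    0 < (i : ℕ) ∧ ∃ h : (i : ℕ) + 1 < n, π ⟨i - 1, by omega⟩ < π i ∧ π ⟨i + 1, h⟩ < π i).card

/-- The inverse peak number `ipk π = pk (π⁻¹)`. -/
def ipk {n : ℕ} (π : Equiv.Perm (Fin n)) : ℕ :=
  peakNumber π⁻¹

/-- The polynomial `P_{σ,n}^{ipk}(s,t) = ∑_{π ∈ 𝔖_n} s^{occ_σ(π)} t^{ipk(π)+1}` for `n ≥ 1`, and
`1` for `n = 0`, evaluated at elements `s`, `t` of an arbitrary commutative ring. -/
def ipkPoly {m : ℕ} {A : Type*} [CommRing A] (σ : Equiv.Perm (Fin m)) (n : ℕ) (s t : A) : A :=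
  if n = 0 then 1 else ∑ π : Equiv.Perm (Fin n), s ^ occ σ π * t ^ (ipk π + 1)

/-- The polynomial `P_{σ,n}^{ipk}(t) = P_{σ,n}^{ipk}(0,t)`, which counts the permutations avoiding
`σ` by inverse peak number. -/
def ipkPolyAvoid {m : ℕ} {A : Type*} [CommRing A] (σ : Equiv.Perm (Fin m)) (n : ℕ) (t : A) : A :=
  ipkPoly σ n 0 t

/-! ### Formal power series with a Hadamard product -/

noncomputable section

/-- Formal power series in two variables `t` and `x` over `R`, viewed as power series in `t` (the
outer variable) whose coefficients are power series in `x` (the inner variable). -/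
abbrev SeriesTX (R : Type*) [CommRing R] : Type _ := PowerSeries (PowerSeries R)

/-- The variable `t`. -/
def tVar (R : Type*) [CommRing R] : SeriesTX R := PowerSeries.X

/-- The variable `x`. -/
def xVar (R : Type*) [CommRing R] : SeriesTX R := PowerSeries.C PowerSeries.X

/-- The coefficient of `t ^ i * x ^ j`. -/
def coeffTX {R : Type*} [CommRing R] (i j : ℕ) (f : SeriesTX R) : R :=
  PowerSeries.coeff j (PowerSeries.coeff i f)

/-- The product which is the Hadamard product in `t` and the ordinary product in `x`. -/
def hadamard {R : Type*} [CommRing R] (f g : SeriesTX R) : SeriesTX R :=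
  PowerSeries.mk fun i => PowerSeries.coeff i f * PowerSeries.coeff i g

/-- The `n`-fold Hadamard product of `f`; for `n = 0` this is the identity `1 + t + t ^ 2 + ⋯` of
the Hadamard product. -/
def hadamardPow {R : Type*} [CommRing R] (f : SeriesTX R) : ℕ → SeriesTX R
  | 0 => PowerSeries.mk fun _ => 1
  | n + 1 => hadamard (hadamardPow f n) f

/-- The family `f 0, f 1, …` can be summed formally: each monomial in `t` and `x` has a nonzero
coefficient in only finitely many members. -/
def FormallySummable {R : Type*} [CommRing R] (f : ℕ → SeriesTX R) : Prop :=
  ∀ i j : ℕ, {n : ℕ | coeffTX i j (f n) ≠ 0}.Finite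

/-- The coefficientwise sum of a formally summable family. -/
def formalSum {R : Type*} [CommRing R] (f : ℕ → SeriesTX R) : SeriesTX R :=
  PowerSeries.mk fun i => PowerSeries.mk fun j => ∑ᶠ n : ℕ, coeffTX i j (f n)

/-- `u = 4t / (1 + t) ^ 2`. -/
def uSer (R : Type*) [CommRing R] : SeriesTX R :=
  4 * tVar R * ((1 + tVar R) ^ 2)⁻¹ʳ

/-- `z = (1 + t) x / (1 - t)`. -/
def zSer (R : Type*) [CommRing R] : SeriesTX R :=
  (1 + tVar R) * xVar R * (1 - tVar R)⁻¹ʳ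

end

/-! ### Sums over words and chains of letters -/

/-! Compare coefficients of `t ^ k` for fixed `k`. The Hadamard product multiplies these
coefficients, so the right-hand side becomes a geometric series `1 / (1 - Fₖ)`, where `Fₖ` is the
coefficient of `F`. The left-hand side becomes `occSeries`, which counts the words in `2k` letters
by length and by occurrences of `σ` in their standardizations. It remains to show that `1 - Fₖ` and
`occSeries` are inverse (`occSeries_mul_eq_one`).

Words and permutations: let equal odd letters increase from left to right and equal even letters
from right to left. Listed in the order given by `π⁻¹`, the letters of a word with standardization
`π` form a chain whose steps are the rises and falls of `π⁻¹`. In the generating function over `k`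
each step contributes a factor `y = (1 + t) / (1 - t)` and each peak a further factor `u`
(`evenSeries_chainSteps_one`). The single letter contributes `2t / (1 - t) ^ 2`, which is `(1 + t) /
(2 (1 - t))` times `u * y`; this explains the prefactor and the exponent `ipk + 1`
(`coeffTX_ipk_side`).

Occurrences: this is the cluster method, with `s = 1 + (s - 1)`. Put `b = a - 1` and `c = m - a -
1`. Overlapping occurrences of `σ` are at a distance `g` with `max b c < g < m`. Exchanging the two
letters of the descent turns an occurrence into a chain with a single fall, preceded by a rise, so
an overlap at distance `g` contributes `u * z ^ g` regardless of what came before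
(`patternSum_overlap`, `evenSeries_chainSteps_riseExcept`). The clusters therefore sum to the
geometric series `overlapSeries`. -/

/-- The word `w` extended by `0` to a sequence. -/
def wordExt {K n : ℕ} (w : Fin n → Fin K) : ℕ → ℕ :=
  fun j => if h : j < n then (w ⟨j, h⟩ : ℕ) else 0

/-- The sequence `v` with the letter `x` put in front. -/
def consSeq (x : ℕ) (v : ℕ → ℕ) : ℕ → ℕ
  | 0 => x
  | j + 1 => v j

/-- The sum of `F w` over all words `w` of length `n` with letters smaller than `K`. -/
def wordSum {R : Type*} [CommRing R] (K n : ℕ) (F : (ℕ → ℕ) → R) : R :=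
  ∑ w : Fin n → Fin K, F (wordExt w)

/-- The relation between consecutive letters of a chain: equality is allowed at odd letters if `e`
is true and at even letters if `e` is false. -/
def letterRel (e : Bool) (x y : ℕ) : Prop := x < y ∨ (x = y ∧ x.bodd = e)

instance (e : Bool) (x y : ℕ) : Decidable (letterRel e x y) := by
  unfold letterRel; infer_instance

/-- The first `n + 1` letters of `w` form a chain of type `e`. -/
def IsLetterChain (e : ℕ → Bool) (n : ℕ) (w : ℕ → ℕ) : Prop :=
  ∀ j < n, letterRel (e j) (w j) (w (j + 1))

instance (e : ℕ → Bool) (n : ℕ) (w : ℕ → ℕ) : Decidable (IsLetterChain e n w) := by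
  unfold IsLetterChain; infer_instance

section
variable {R : Type*} [CommRing R]

/-- The vector `ψ` multiplied by the matrix of `letterRel e`. -/
def chainStep (e : Bool) (ψ : ℕ → R) : ℕ → R :=
  fun y => ∑ x ∈ Finset.range y, ψ x + if y.bodd = e then ψ y else 0

/-- The vector `ψ` multiplied by the matrices of `letterRel (e 0)`, …, `letterRel (e (n - 1))`. -/
def chainSteps (e : ℕ → Bool) : ℕ → (ℕ → R) → (ℕ → R)
  | 0, ψ => ψ
  | n + 1, ψ => chainStep (e n) (chainSteps e n ψ)

/-- The sequence `w` without its first `g` letters. -/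
def dropSeq (g : ℕ) (w : ℕ → ℕ) : ℕ → ℕ := fun j => w (g + j)

theorem dropSeq_dropSeq (g h : ℕ) (w : ℕ → ℕ) : dropSeq g (dropSeq h w) = dropSeq (h + g) w := by
  funext j; simp [dropSeq, add_assoc]

@[simp] theorem dropSeq_zero (w : ℕ → ℕ) : dropSeq 0 w = w := by
  funext j; simp [dropSeq]

theorem dropSeq_one_consSeq (x : ℕ) (v : ℕ → ℕ) : dropSeq 1 (consSeq x v) = v := by
  funext j; simp [dropSeq, add_comm 1 j, consSeq]

theorem wordSum_congr {K n : ℕ} {F G : (ℕ → ℕ) → R}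
    (h : ∀ w : ℕ → ℕ, (∀ j < n, w j < K) → F w = G w) : wordSum K n F = wordSum K n G := by
  unfold wordSum
  refine Finset.sum_congr rfl fun w _ => h _ fun j hj => ?_
  simp [wordExt, hj]

theorem wordSum_zero (K : ℕ) (F : (ℕ → ℕ) → R) : wordSum K 0 F = F fun _ => 0 := by
  have : ∀ w : Fin 0 → Fin K, wordExt w = fun _ => 0 := fun w => by funext j; simp [wordExt]
  simp [wordSum, this]

theorem wordExt_cons {K n : ℕ} (x : Fin K) (w : Fin n → Fin K) :
    wordExt (Fin.cons x w : Fin (n + 1) → Fin K) = consSeq x (wordExt w) := by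
  funext j
  cases j with
  | zero => simp [wordExt, consSeq]
  | succ j =>
    by_cases h : j < n
    · have : (⟨j + 1, by omega⟩ : Fin (n + 1)) = Fin.succ ⟨j, h⟩ := rfl
      simp only [wordExt, consSeq, dif_pos h, dif_pos (Nat.succ_lt_succ h), this, Fin.cons_succ]
    · simp [wordExt, consSeq, h]

theorem wordSum_succ (K n : ℕ) (F : (ℕ → ℕ) → R) :
    wordSum K (n + 1) F = wordSum K n fun v => ∑ x ∈ Finset.range K, F (consSeq x v) := by
  unfold wordSum
  rw [← (Fin.consEquiv fun _ : Fin (n + 1) => Fin K).sum_comp, Fintype.sum_prod_type_right]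
  refine Finset.sum_congr rfl fun w _ => ?_
  refine Eq.trans ?_ (Finset.sum_range _).symm
  refine Finset.sum_congr rfl fun x _ => ?_
  rw [← wordExt_cons]; rfl

/-- Permuting positions reindexes the sum. The condition `h'` keeps positions beyond the word, where
the extension is `0`, beyond the word. -/
theorem wordSum_comp_perm (K n : ℕ) (F : (ℕ → ℕ) → R) (τ : Equiv.Perm (Fin n)) (τ' : ℕ → ℕ)
    (h : ∀ j : Fin n, τ' j = τ j) (h' : ∀ j, n ≤ j → n ≤ τ' j) :
    wordSum K n (fun w => F (w ∘ τ')) = wordSum K n F := by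
  unfold wordSum
  rw [← (Equiv.arrowCongr τ (Equiv.refl (Fin K))).sum_comp]
  refine Finset.sum_congr rfl fun w _ => congrArg F ?_
  funext j
  by_cases hj : j < n
  · have := h ⟨j, hj⟩
    simp only at this
    simp [wordExt, hj, this]
  · simp [wordExt, hj, h' j (by omega)]

theorem swap_lt_iff {b n : ℕ} (hb : b + 1 < n) (j : ℕ) : Equiv.swap b (b + 1) j < n ↔ j < n := by
  rw [Equiv.swap_apply_def]; split_ifs <;> omega

theorem wordSum_comp_swap (K : ℕ) {n b : ℕ} (hb : b + 1 < n) (F : (ℕ → ℕ) → R) :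
    wordSum K n (fun w => F (w ∘ Equiv.swap b (b + 1))) = wordSum K n F := by
  refine wordSum_comp_perm K n F (Equiv.swap ⟨b, by omega⟩ ⟨b + 1, hb⟩) _ (fun j => ?_) ?_
  · simp only [Equiv.swap_apply_def, Fin.ext_iff]; split_ifs <;> rfl
  · intro j hj
    rw [← not_lt, swap_lt_iff hb]; omega

theorem wordSum_mul_left (K n : ℕ) (F : (ℕ → ℕ) → R) (r : R) :
    wordSum K n (fun w => r * F w) = r * wordSum K n F := by
  simp [wordSum, Finset.mul_sum]

theorem wordSum_add (K n : ℕ) (F G : (ℕ → ℕ) → R) :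
    wordSum K n (fun w => F w + G w) = wordSum K n F + wordSum K n G := by
  simp [wordSum, Finset.sum_add_distrib]

theorem wordSum_sum {ι : Type*} (K n : ℕ) (s : Finset ι) (F : ι → (ℕ → ℕ) → R) :
    wordSum K n (fun w => ∑ i ∈ s, F i w) = ∑ i ∈ s, wordSum K n (F i) := by
  simp only [wordSum]; exact Finset.sum_comm

theorem sum_letterRel {K y : ℕ} (hy : y < K) (e : Bool) (ψ : ℕ → R) :
    ∑ x ∈ Finset.range K, (if letterRel e x y then ψ x else 0) = chainStep e ψ y := by
  have hsub : Finset.range (y + 1) ⊆ Finset.range K := Finset.range_subset_range.2 hy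
  rw [← Finset.sum_subset hsub, Finset.sum_range_succ, chainStep]
  · congr 1
    · refine Finset.sum_congr rfl fun x hx => ?_
      exact if_pos (Or.inl (Finset.mem_range.1 hx))
    · simp [letterRel]
  · intro x _ hx
    rw [if_neg]
    rw [Finset.mem_range] at hx
    unfold letterRel; omega

theorem wordSum_chain_one (K n : ℕ) (e : Bool) (ψ : ℕ → R) (F : (ℕ → ℕ) → R) :
    wordSum K (n + 2) (fun w => if letterRel e (w 0) (w 1) then ψ (w 0) * F (dropSeq 1 w) else 0)
      = wordSum K (n + 1) fun v => chainStep e ψ (v 0) * F v := by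
  rw [wordSum_succ]
  refine wordSum_congr fun v hv => ?_
  rw [← sum_letterRel (hv 0 (by omega)), Finset.sum_mul]
  refine Finset.sum_congr rfl fun x _ => ?_
  simp only [dropSeq_one_consSeq, consSeq, ite_mul, zero_mul]

/-- Transfer matrix method: the letters before position `g` are summed out, and their effect is a
vector indexed by the letter at position `g`. -/
theorem wordSum_chain (K n : ℕ) (e : ℕ → Bool) (ψ : ℕ → R) (g : ℕ) (F : (ℕ → ℕ) → R) :
    wordSum K (g + n + 1) (fun w => if IsLetterChain e g w then ψ (w 0) * F (dropSeq g w) else 0)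
      = wordSum K (n + 1) fun v => chainSteps e g ψ (v 0) * F v := by
  induction g generalizing F n with
  | zero => simp [IsLetterChain, chainSteps]
  | succ g ih =>
    -- The last step of the chain is first absorbed into `F` and then summed out by
    -- `wordSum_chain_one`.
    have := ih (n + 1) (fun v => if letterRel (e g) (v 0) (v 1) then F (dropSeq 1 v) else 0)
    rw [show g + 1 + n + 1 = g + (n + 1) + 1 by ring, chainSteps, ← wordSum_chain_one]
    refine Eq.trans (wordSum_congr fun w _ => ?_) (this.trans (wordSum_congr fun w _ => ?_))
    · simp only [IsLetterChain, Nat.forall_lt_succ_right, dropSeq_dropSeq]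
      simp only [dropSeq, add_zero]
      by_cases h1 : ∀ j < g, letterRel (e j) (w j) (w (j + 1)) <;>
        by_cases h2 : letterRel (e g) (w g) (w (g + 1)) <;> simp [h1, h2]
    · simp

theorem wordSum_head_mul (K n : ℕ) (ψ : ℕ → R) (F : (ℕ → ℕ) → R) :
    wordSum K (n + 1) (fun v => ψ (v 0) * F (dropSeq 1 v))
      = (∑ x ∈ Finset.range K, ψ x) * wordSum K n F := by
  rw [wordSum_succ, ← wordSum_mul_left]
  refine wordSum_congr fun v _ => ?_
  simp [dropSeq_one_consSeq, consSeq, Finset.sum_mul]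

end

/-! ### Generating functions of chains -/

section
variable {R : Type*} [CommRing R]

/-- The series `∑ₖ (∑_{x < 2k} ψ x) tᵏ`. -/
noncomputable def evenSeries (ψ : ℕ → R) : SeriesTX R :=
  PowerSeries.mk fun k => PowerSeries.C (∑ x ∈ Finset.range (2 * k), ψ x)

/-- The series `∑ₖ (∑_{x < 2k - 1} ψ x) tᵏ`. -/
noncomputable def oddSeries (ψ : ℕ → R) : SeriesTX R :=
  PowerSeries.mk fun k => PowerSeries.C (∑ x ∈ Finset.range (2 * k - 1), ψ x)

/-- The two series differ by the values at the odd letters `2k - 1`, where a rise allows equality.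
The next three relations likewise split off one letter according to its parity. -/
theorem evenSeries_step_true_sub (ψ : ℕ → R) :
    evenSeries (chainStep true ψ) = oddSeries (chainStep true ψ) + evenSeries ψ := by
  refine PowerSeries.ext fun k => ?_
  cases k with
  | zero => simp [evenSeries, oddSeries]
  | succ k =>
    rw [map_add]
    simp only [evenSeries, oddSeries, PowerSeries.coeff_mk, ← map_add]
    rw [show 2 * (k + 1) = 2 * k + 1 + 1 by ring, Nat.add_sub_cancel, Finset.sum_range_succ,
      Finset.sum_range_succ _ (2 * k + 1)]
    congr 2
    simp [chainStep]

theorem oddSeries_step_true (ψ : ℕ → R) :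
    oddSeries (chainStep true ψ) = tVar R * (evenSeries (chainStep true ψ) + evenSeries ψ) := by
  refine PowerSeries.ext fun k => ?_
  cases k with
  | zero => simp [oddSeries, tVar]
  | succ k =>
    rw [tVar, PowerSeries.coeff_succ_X_mul, map_add]
    simp only [evenSeries, oddSeries, PowerSeries.coeff_mk, ← map_add]
    rw [show 2 * (k + 1) - 1 = 2 * k + 1 by omega, Finset.sum_range_succ]
    congr 2
    simp [chainStep]

theorem evenSeries_step_false_sub (ψ : ℕ → R) :
    evenSeries (chainStep false ψ) = oddSeries (chainStep false ψ) + oddSeries ψ := by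
  refine PowerSeries.ext fun k => ?_
  cases k with
  | zero => simp [evenSeries, oddSeries]
  | succ k =>
    rw [map_add]
    simp only [evenSeries, oddSeries, PowerSeries.coeff_mk, ← map_add]
    rw [show 2 * (k + 1) = 2 * k + 1 + 1 by ring, Nat.add_sub_cancel, Finset.sum_range_succ]
    congr 2
    simp [chainStep]

theorem oddSeries_step_false (ψ : ℕ → R) :
    oddSeries (chainStep false ψ) = tVar R * evenSeries (chainStep false ψ) + oddSeries ψ := by
  refine PowerSeries.ext fun k => ?_
  cases k with
  | zero => simp [oddSeries, tVar]
  | succ k =>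
    rw [map_add, tVar, PowerSeries.coeff_succ_X_mul]
    simp only [evenSeries, oddSeries, PowerSeries.coeff_mk, ← map_add]
    rw [show 2 * (k + 1) - 1 = 2 * k + 1 by omega, Finset.sum_range_succ, Finset.sum_range_succ]
    congr 2
    simp [chainStep]

theorem isUnit_one_sub_tVar : IsUnit (1 - tVar R) := by
  rw [PowerSeries.isUnit_iff_constantCoeff]; simp [tVar]

theorem isUnit_one_add_tVar : IsUnit (1 + tVar R) := by
  rw [PowerSeries.isUnit_iff_constantCoeff]; simp [tVar]

/-- `(1 + t) / (1 - t)`. -/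
noncomputable def ySer (R : Type*) [CommRing R] : SeriesTX R :=
  (1 + tVar R) * (1 - tVar R)⁻¹ʳ

theorem one_sub_tVar_mul_ySer : (1 - tVar R) * ySer R = 1 + tVar R := by
  rw [ySer, mul_left_comm, Ring.mul_inverse_cancel _ isUnit_one_sub_tVar, mul_one]

theorem one_add_tVar_sq_mul_uSer : (1 + tVar R) ^ 2 * uSer R = 4 * tVar R := by
  rw [uSer, mul_left_comm, Ring.mul_inverse_cancel _ (isUnit_one_add_tVar.pow 2), mul_one]

theorem zSer_eq : zSer R = ySer R * xVar R := by
  rw [zSer, ySer]; ring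

theorem evenSeries_step_true (ψ : ℕ → R) :
    evenSeries (chainStep true ψ) = ySer R * evenSeries ψ := by
  refine isUnit_one_sub_tVar.mul_left_cancel (b := evenSeries (chainStep true ψ)) ?_
  linear_combination evenSeries_step_true_sub ψ + oddSeries_step_true ψ
    - evenSeries ψ * one_sub_tVar_mul_ySer (R := R)

/-- After a rise the ratio of `oddSeries` to `evenSeries` is `2t : (1 + t)`; after a fall it is `(1
+ t) : 2`. A subsequent fall depends only on `oddSeries`, which is how it detects a peak. -/
theorem one_add_tVar_mul_oddSeries_step_true (ψ : ℕ → R) :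
    (1 + tVar R) * oddSeries (chainStep true ψ) = 2 * tVar R * evenSeries (chainStep true ψ) := by
  linear_combination oddSeries_step_true ψ - tVar R * evenSeries_step_true_sub ψ

theorem one_sub_tVar_mul_evenSeries_step_false (ψ : ℕ → R) :
    (1 - tVar R) * evenSeries (chainStep false ψ) = 2 * oddSeries ψ := by
  linear_combination evenSeries_step_false_sub ψ + oddSeries_step_false ψ

theorem two_mul_oddSeries_step_false (ψ : ℕ → R) :
    2 * oddSeries (chainStep false ψ) = (1 + tVar R) * evenSeries (chainStep false ψ) := by
  linear_combination oddSeries_step_false ψ - evenSeries_step_false_sub ψ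

/-- A rise followed by a fall contributes a factor `u`. -/
theorem evenSeries_step_false_of_rise {ψ : ℕ → R}
    (h : (1 + tVar R) * oddSeries ψ = 2 * tVar R * evenSeries ψ) :
    evenSeries (chainStep false ψ) = uSer R * ySer R * evenSeries ψ := by
  refine ((isUnit_one_add_tVar.pow 2).mul isUnit_one_sub_tVar).mul_left_cancel
    (b := evenSeries (chainStep false ψ)) ?_
  linear_combination (1 + tVar R) ^ 2 * one_sub_tVar_mul_evenSeries_step_false ψ
    + 2 * (1 + tVar R) * h
    - evenSeries ψ * (ySer R * (1 - tVar R)) * one_add_tVar_sq_mul_uSer (R := R)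
    - evenSeries ψ * 4 * tVar R * one_sub_tVar_mul_ySer (R := R)

theorem evenSeries_step_false_of_fall {ψ : ℕ → R}
    (h : 2 * oddSeries ψ = (1 + tVar R) * evenSeries ψ) :
    evenSeries (chainStep false ψ) = ySer R * evenSeries ψ := by
  refine isUnit_one_sub_tVar.mul_left_cancel (b := evenSeries (chainStep false ψ)) ?_
  linear_combination one_sub_tVar_mul_evenSeries_step_false ψ + h
    - evenSeries ψ * one_sub_tVar_mul_ySer (R := R)

/-- The constant vector has the same ratio as a vector obtained by a fall, so a fall at the start of
a chain is not a peak. -/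
theorem two_mul_oddSeries_one :
    2 * oddSeries (fun _ => (1 : R)) = (1 + tVar R) * evenSeries fun _ => (1 : R) := by
  refine PowerSeries.ext fun k => ?_
  rw [add_mul, one_mul, map_add, two_mul, map_add]
  cases k with
  | zero => simp [oddSeries, evenSeries, tVar]
  | succ k =>
    rw [tVar, PowerSeries.coeff_succ_X_mul]
    simp only [evenSeries, oddSeries, PowerSeries.coeff_mk, ← map_add]
    congr 1
    rw [show 2 * (k + 1) - 1 = 2 * k + 1 by omega]
    simp; ring

theorem one_sub_tVar_sq_mul_evenSeries_one :
    (1 - tVar R) ^ 2 * evenSeries (fun _ => (1 : R)) = 2 * tVar R := by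
  have h : (1 - tVar R) * evenSeries (fun _ => (1 : R))
      = 2 * tVar R * PowerSeries.mk fun _ => 1 := by
    refine PowerSeries.ext fun k => ?_
    rw [sub_mul, one_mul, map_sub, mul_assoc, two_mul, map_add]
    cases k with
    | zero => simp [evenSeries, tVar]
    | succ k =>
      rw [tVar, PowerSeries.coeff_succ_X_mul, PowerSeries.coeff_succ_X_mul]
      simp only [evenSeries, PowerSeries.coeff_mk, ← map_sub]
      simp
      ring_nf
      exact map_ofNat _ 2
  have h2 : (PowerSeries.mk fun _ => 1) * (1 - tVar R) = 1 := PowerSeries.mk_one_mul_one_sub_eq_one _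
  linear_combination (1 - tVar R) * h + 2 * tVar R * h2

/-! ### Chains with prescribed rises and falls -/

/-- The number of peaks of a sequence of `n` rises (`true`) and falls (`false`). -/
def chainPeaks (e : ℕ → Bool) (n : ℕ) : ℕ :=
  ((Finset.range n).filter fun j => 0 < j ∧ e (j - 1) = true ∧ e j = false).card

theorem chainPeaks_succ (e : ℕ → Bool) (n : ℕ) :
    chainPeaks e (n + 1)
      = chainPeaks e n + if 0 < n ∧ e (n - 1) = true ∧ e n = false then 1 else 0 := by
  unfold chainPeaks
  rw [Finset.range_add_one, Finset.filter_insert]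
  split_ifs with h
  · rw [Finset.card_insert_of_notMem (by simp)]
  · rfl

theorem evenSeries_chainSteps_one (e : ℕ → Bool) (n : ℕ) :
    evenSeries (chainSteps e n fun _ => (1 : R))
      = uSer R ^ chainPeaks e n * ySer R ^ n * evenSeries fun _ => 1 := by
  induction n with
  | zero => simp [chainPeaks, chainSteps]
  | succ n ih =>
    rw [chainPeaks_succ, chainSteps]
    cases hn : e n with
    | true =>
      rw [evenSeries_step_true, ih]
      simp only [Bool.true_eq_false, and_false, if_false]
      ring
    | false =>
      cases n with
      | zero =>
        rw [show chainSteps e 0 (fun _ => (1 : R)) = fun _ => 1 from rfl,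
          evenSeries_step_false_of_fall two_mul_oddSeries_one]
        simp [chainPeaks]
      | succ n =>
        simp only [Nat.succ_pos, Nat.add_sub_cancel, true_and, and_true]
        cases hn' : e n with
        | true =>
          rw [evenSeries_step_false_of_rise, ih]
          · simp only [if_true]; ring
          · rw [chainSteps, hn']; exact one_add_tVar_mul_oddSeries_step_true _
        | false =>
          rw [evenSeries_step_false_of_fall, ih]
          · simp only [Bool.false_eq_true, if_false]; ring
          · rw [chainSteps, hn']; exact two_mul_oddSeries_step_false _

/-- A chain all of whose steps except step number `b` are rises. -/
def riseExcept (b : ℕ) : ℕ → Bool := fun j => decide (j ≠ b)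

theorem evenSeries_chainSteps_riseExcept_of_le {b n : ℕ} (hn : n ≤ b) (ψ : ℕ → R) :
    evenSeries (chainSteps (riseExcept b) n ψ) = ySer R ^ n * evenSeries ψ := by
  induction n with
  | zero => simp [chainSteps]
  | succ n ih =>
    have h : riseExcept b n = true := by simp [riseExcept]; omega
    rw [chainSteps, h, evenSeries_step_true, ih (by omega)]; ring

/-- Since `1 ≤ b`, the fall is preceded by a rise within the chain itself, so the factor `u` arises
for every `ψ`. This makes the contributions of successive overlaps independent. -/
theorem evenSeries_chainSteps_riseExcept {b n : ℕ} (hb : 1 ≤ b) (hn : b + 1 ≤ n) (ψ : ℕ → R) :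
    evenSeries (chainSteps (riseExcept b) n ψ) = uSer R * ySer R ^ n * evenSeries ψ := by
  induction n, hn using Nat.le_induction with
  | base =>
    have h : riseExcept b b = false := by simp [riseExcept]
    rw [chainSteps, h, evenSeries_step_false_of_rise,
      evenSeries_chainSteps_riseExcept_of_le le_rfl]
    · ring
    · obtain ⟨b, rfl⟩ : ∃ b', b = b' + 1 := ⟨b - 1, by omega⟩
      have h : riseExcept (b + 1) b = true := by simp [riseExcept]
      rw [chainSteps, h]; exact one_add_tVar_mul_oddSeries_step_true _
  | succ n hn ih =>
    have h : riseExcept b n = true := by simp [riseExcept]; omega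
    rw [chainSteps, h, evenSeries_step_true, ih]; ring

end

/-! ### The pattern as a condition on words -/

/-- The first `b + c + 2` letters of `w` form the pattern `1 2 ⋯ b (b+2) (b+1) (b+3) ⋯ (b+c+2)`. -/
def StartsWithPattern (b c : ℕ) (w : ℕ → ℕ) : Prop :=
  IsLetterChain (riseExcept b) (b + c + 1) (w ∘ Equiv.swap b (b + 1))

instance (b c : ℕ) (w : ℕ → ℕ) : Decidable (StartsWithPattern b c w) := by
  unfold StartsWithPattern; infer_instance

theorem letterRel_trans {e e' : Bool} {x y z : ℕ} (h : letterRel e x y) (h' : letterRel e' y z) :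
    letterRel e x z := by
  unfold letterRel at *
  rcases h with h | ⟨rfl, h⟩ <;> rcases h' with h' | ⟨rfl, h'⟩
  · left; omega
  · left; omega
  · left; omega
  · right; exact ⟨rfl, h⟩

theorem letterRel_trans_right {e e' : Bool} {x y z : ℕ} (h : letterRel e x y)
    (h' : letterRel e' y z) : letterRel e' x z := by
  unfold letterRel at *
  rcases h with h | ⟨rfl, h⟩ <;> rcases h' with h' | ⟨rfl, h'⟩
  · left; omega
  · left; omega
  · left; omega
  · right; exact ⟨rfl, h'⟩

theorem not_letterRel_false_of_true {x y : ℕ} (h : letterRel true x y) : ¬letterRel false y x := by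
  unfold letterRel at *
  rintro (h' | ⟨rfl, h'⟩)
  · omega
  · rcases h with h | ⟨-, h⟩
    · omega
    · rw [h] at h'; cases h'

theorem riseExcept_of_ne {b j : ℕ} (h : j ≠ b) : riseExcept b j = true := by
  simp [riseExcept, h]

theorem riseExcept_self (b : ℕ) : riseExcept b b = false := by
  simp [riseExcept]

theorem swap_succ_of_lt {b j : ℕ} (h : j < b) : Equiv.swap b (b + 1) j = j :=
  Equiv.swap_apply_of_ne_of_ne (by omega) (by omega)

theorem swap_succ_of_gt {b j : ℕ} (h : b + 1 < j) : Equiv.swap b (b + 1) j = j :=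
  Equiv.swap_apply_of_ne_of_ne (by omega) (by omega)

theorem StartsWithPattern.fall {b c : ℕ} {w : ℕ → ℕ} (h : StartsWithPattern b c w) :
    letterRel false (w (b + 1)) (w b) := by
  have := h b (by omega)
  simpa [riseExcept_self] using this

theorem StartsWithPattern.rise {b c : ℕ} {w : ℕ → ℕ} (h : StartsWithPattern b c w) {j : ℕ}
    (hj : j < b + c + 1) (hjb : j ≠ b) : letterRel true (w j) (w (j + 1)) := by
  have hj' := h j hj
  rw [riseExcept_of_ne hjb] at hj'
  simp only [Function.comp_apply] at hj'
  rcases lt_trichotomy (j + 1) b with h1 | h1 | h1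
  · rwa [swap_succ_of_lt (by omega), swap_succ_of_lt h1] at hj'
  · subst h1
    rw [swap_succ_of_lt (by omega), Equiv.swap_apply_left] at hj'
    exact letterRel_trans hj' h.fall
  · rcases eq_or_lt_of_le (show b + 1 ≤ j by omega) with h2 | h2
    · subst h2
      rw [Equiv.swap_apply_right, swap_succ_of_gt (by omega)] at hj'
      exact letterRel_trans_right h.fall hj'
    · rwa [swap_succ_of_gt h2, swap_succ_of_gt (by omega)] at hj'

/-- If `g ≤ b`, the descent of the first occurrence lies on a rise of the second; if `g ≤ c`, the
descent of the second lies on a rise of the first. -/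
theorem StartsWithPattern.not_dropSeq {b c g : ℕ} {w : ℕ → ℕ} (h : StartsWithPattern b c w)
    (hg : 1 ≤ g) (hg' : g ≤ max b c) : ¬StartsWithPattern b c (dropSeq g w) := by
  intro h'
  rcases le_max_iff.1 hg' with hb | hc
  · have h1 := h'.rise (j := b - g) (by omega) (by omega)
    simp only [dropSeq] at h1
    rw [show g + (b - g) = b by omega, show g + (b - g + 1) = b + 1 by omega] at h1
    exact not_letterRel_false_of_true h1 h.fall
  · have h1 := h.rise (j := g + b) (by omega) (by omega)
    have h2 := h'.fall
    simp only [dropSeq] at h2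
    exact not_letterRel_false_of_true h1 h2

theorem dropSeq_comp_swap {b g : ℕ} (hg : b + 2 ≤ g) (w : ℕ → ℕ) :
    dropSeq g (w ∘ Equiv.swap b (b + 1)) = dropSeq g w := by
  funext j
  simp only [dropSeq, Function.comp_apply]
  rw [swap_succ_of_gt (by omega)]

theorem startsWithPattern_comp_swap {b c : ℕ} {w : ℕ → ℕ} :
    StartsWithPattern b c (w ∘ Equiv.swap b (b + 1))
      ↔ IsLetterChain (riseExcept b) (b + c + 1) w := by
  unfold StartsWithPattern
  have : (w ∘ Equiv.swap b (b + 1)) ∘ Equiv.swap b (b + 1) = w := by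
    funext j; simp
  rw [this]

/-- After the exchange the first occurrence is a chain. Its steps from `g` on are rises that the
second occurrence already imposes, so only the first `g` steps are a separate condition. -/
theorem startsWithPattern_overlap {b c g : ℕ} (hb : 1 ≤ b) (hc : 1 ≤ c) (hbc : 3 ≤ b + c)
    (hg : max b c < g) (hg' : g < b + c + 2) (w : ℕ → ℕ) :
    (StartsWithPattern b c (w ∘ Equiv.swap b (b + 1))
        ∧ StartsWithPattern b c (dropSeq g (w ∘ Equiv.swap b (b + 1))))
      ↔ IsLetterChain (riseExcept b) g w ∧ StartsWithPattern b c (dropSeq g w) := by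
  rw [startsWithPattern_comp_swap]
  have hbg : b < g := lt_of_le_of_lt (le_max_left _ _) hg
  have hcg : c < g := lt_of_le_of_lt (le_max_right _ _) hg
  have hchain : IsLetterChain (riseExcept b) g w → StartsWithPattern b c (dropSeq g w) →
      IsLetterChain (riseExcept b) (b + c + 1) w := by
    intro h h' j hj
    by_cases hjg : j < g
    · exact h j hjg
    · have h1 := h'.rise (j := j - g) (by omega) (by omega)
      simp only [dropSeq] at h1
      rw [show g + (j - g) = j by omega, show g + (j - g + 1) = j + 1 by omega] at h1
      rwa [riseExcept_of_ne (by omega)]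
  -- Only for `g = b + 1` does the exchange reach the second occurrence. Then `c ≤ b`, hence `2 ≤
  -- b`, and just its first letter changes, which is compared only with `w (b + 2)`.
  rcases eq_or_lt_of_le (show b + 1 ≤ g from hbg) with h | h
  · subst h
    have key : letterRel false (w b) (w (b + 1)) → letterRel true (w (b + 1)) (w (b + 2)) →
        (StartsWithPattern b c (dropSeq (b + 1) (w ∘ Equiv.swap b (b + 1)))
          ↔ StartsWithPattern b c (dropSeq (b + 1) w)) := by
      intro h1 h2
      unfold StartsWithPattern IsLetterChain
      refine forall_congr' fun j => forall_congr' fun hj => ?_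
      cases j with
      | zero =>
        simp only [Function.comp_apply, dropSeq]
        rw [swap_succ_of_lt (show 0 < b by omega), swap_succ_of_lt (show 0 + 1 < b by omega),
          riseExcept_of_ne (by omega), add_zero, Equiv.swap_apply_right,
          swap_succ_of_gt (show b + 1 < b + 1 + (0 + 1) by omega)]
        exact iff_of_true (letterRel_trans_right h1 h2) h2
      | succ j =>
        have hpos : ∀ i, 1 ≤ i → 1 ≤ Equiv.swap b (b + 1) i := by
          intro i hi
          rw [Equiv.swap_apply_def]; split_ifs <;> omega
        have hp1 := hpos (j + 1) (by omega)
        have hp2 := hpos (j + 1 + 1) (by omega)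
        simp only [Function.comp_apply, dropSeq]
        rw [swap_succ_of_gt (j := b + 1 + Equiv.swap b (b + 1) (j + 1)) (by omega),
          swap_succ_of_gt (j := b + 1 + Equiv.swap b (b + 1) (j + 1 + 1)) (by omega)]
    constructor
    · rintro ⟨h1, h2⟩
      refine ⟨fun j hj => h1 j (by omega), (key ?_ ?_).1 h2⟩
      · simpa [riseExcept_self] using h1 b (by omega)
      · simpa [riseExcept_of_ne] using h1 (b + 1) (by omega)
    · rintro ⟨h1, h2⟩
      have h3 := hchain h1 h2
      refine ⟨h3, (key ?_ ?_).2 h2⟩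
      · simpa [riseExcept_self] using h3 b (by omega)
      · simpa [riseExcept_of_ne] using h3 (b + 1) (by omega)
  · rw [dropSeq_comp_swap h]
    exact ⟨fun ⟨h1, h2⟩ => ⟨fun j hj => h1 j (by omega), h2⟩, fun ⟨h1, h2⟩ => ⟨hchain h1 h2, h2⟩⟩

/-! ### Words weighted by the number of occurrences of the pattern -/

section
variable {R : Type*} [CommRing R]

/-- The factor `s` if the pattern occurs at position `i` of the word consisting of the first `n`
letters of `w`, and `1` otherwise. -/
def occFactor (s : R) (b c n : ℕ) (w : ℕ → ℕ) (i : ℕ) : R :=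
  if i + (b + c + 2) ≤ n ∧ StartsWithPattern b c (dropSeq i w) then s else 1

/-- `s` to the number of occurrences of the pattern in the first `n` letters of `w`. -/
def occWeight (s : R) (b c n : ℕ) (w : ℕ → ℕ) : R :=
  ∏ i ∈ Finset.range n, occFactor s b c n w i

theorem occWeight_succ (s : R) (b c n : ℕ) (w : ℕ → ℕ) :
    occWeight s b c (n + 1) w
      = occFactor s b c (n + 1) w 0 * occWeight s b c n (dropSeq 1 w) := by
  rw [occWeight, Finset.prod_range_succ', mul_comm]
  congr 1
  refine Finset.prod_congr rfl fun i _ => ?_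
  unfold occFactor
  have h : (i + 1 + (b + c + 2) ≤ n + 1) ↔ i + (b + c + 2) ≤ n := by omega
  simp only [dropSeq_dropSeq, add_comm 1 i, h]

theorem occWeight_dropSeq (s : R) (b c n : ℕ) (w : ℕ → ℕ) {g : ℕ} (hg : g < n) :
    occWeight s b c (n - g) (dropSeq g w)
      = occWeight s b c (n - (g + 1)) (dropSeq (g + 1) w)
        + (s - 1) * if g + (b + c + 2) ≤ n ∧ StartsWithPattern b c (dropSeq g w)
            then occWeight s b c (n - (g + 1)) (dropSeq (g + 1) w) else 0 := by
  obtain ⟨r, rfl⟩ : ∃ r, n = g + r + 1 := ⟨n - g - 1, by omega⟩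
  rw [show g + r + 1 - g = r + 1 by omega, show g + r + 1 - (g + 1) = r by omega, occWeight_succ,
    occFactor, dropSeq_dropSeq, dropSeq_dropSeq, add_zero]
  have h : (0 + (b + c + 2) ≤ r + 1) ↔ g + (b + c + 2) ≤ g + r + 1 := by omega
  simp only [h]
  split_ifs <;> ring

/-- Each factor is `1` plus `s - 1` times an indicator. The product is expanded according to the
first position in `[1, k)` at which `s - 1` is chosen. -/
theorem occWeight_telescope (s : R) (b c n : ℕ) (w : ℕ → ℕ) {k : ℕ} (hk : 1 ≤ k) (hkn : k ≤ n) :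
    occWeight s b c (n - 1) (dropSeq 1 w)
      = occWeight s b c (n - k) (dropSeq k w)
        + (s - 1) * ∑ g ∈ Finset.Ico 1 k,
          if g + (b + c + 2) ≤ n ∧ StartsWithPattern b c (dropSeq g w)
            then occWeight s b c (n - (g + 1)) (dropSeq (g + 1) w) else 0 := by
  induction k, hk using Nat.le_induction with
  | base => simp
  | succ k hk ih =>
    rw [ih (by omega), occWeight_dropSeq s b c n w (by omega : k < n), Finset.sum_Ico_succ_top hk]
    ring

/-- The weighted number of words of length `n`. -/
def occSum (s : R) (b c K n : ℕ) : R :=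
  wordSum K n (occWeight s b c n)

/-- The weighted number of words of length `n` that start with the pattern, where the occurrence at
the start is not weighted by `s` but by the value of `ψ` at the first letter. -/
def patternSum (s : R) (b c K : ℕ) (ψ : ℕ → R) (n : ℕ) : R :=
  wordSum K n fun w => if b + c + 2 ≤ n ∧ StartsWithPattern b c w
    then ψ (w 0) * occWeight s b c (n - 1) (dropSeq 1 w) else 0

theorem patternSum_of_lt (s : R) (b c K : ℕ) (ψ : ℕ → R) {n : ℕ} (hn : n < b + c + 2) :
    patternSum s b c K ψ n = 0 := by
  simp [patternSum, wordSum, hn.not_ge]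

theorem occSum_zero (s : R) (b c K : ℕ) : occSum s b c K 0 = 1 := by
  simp [occSum, wordSum_zero, occWeight]

theorem occSum_succ (s : R) (b c K n : ℕ) :
    occSum s b c K (n + 1)
      = K * occSum s b c K n + (s - 1) * patternSum s b c K (fun _ => 1) (n + 1) := by
  have h := wordSum_head_mul K n (fun _ => (1 : R)) (occWeight s b c n)
  simp only [Finset.sum_const, Finset.card_range, nsmul_eq_mul, mul_one] at h
  rw [occSum, occSum, ← h, patternSum, ← wordSum_mul_left, ← wordSum_add]
  refine wordSum_congr fun w _ => ?_
  rw [occWeight_succ, occFactor]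
  simp only [zero_add, dropSeq_zero, Nat.add_sub_cancel]
  split_ifs <;> ring

/-- No further occurrence is marked inside the leading one, so the exchange gives a full chain of `b
+ c + 2` letters followed by an unrelated word. -/
theorem patternSum_leading (s : R) (b c K : ℕ) (hb : 1 ≤ b) (ψ : ℕ → R) (r : ℕ) :
    wordSum K (b + c + 2 + r) (fun w => if StartsWithPattern b c w
        then ψ (w 0) * occWeight s b c r (dropSeq (b + c + 2) w) else 0)
      = (∑ x ∈ Finset.range K, chainSteps (riseExcept b) (b + c + 1) ψ x) * occSum s b c K r := by
  rw [occSum, ← wordSum_head_mul,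
    ← wordSum_chain _ _ _ _ _ fun v => occWeight s b c r (dropSeq 1 v),
    ← wordSum_comp_swap K (b := b) (by omega),
    show b + c + 2 + r = b + c + 1 + r + 1 by ring]
  refine wordSum_congr fun w _ => ?_
  rw [dropSeq_comp_swap (by omega), dropSeq_dropSeq, Function.comp_apply,
    swap_succ_of_lt (by omega)]
  simp only [startsWithPattern_comp_swap]

theorem patternSum_overlap (s : R) {b c g : ℕ} (K : ℕ) (hb : 1 ≤ b) (hc : 1 ≤ c)
    (hbc : 3 ≤ b + c) (hg : max b c < g) (hg' : g < b + c + 2) (ψ : ℕ → R) (n : ℕ)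
    (hn : b + c + 2 ≤ n) :
    wordSum K n (fun w => if StartsWithPattern b c w then ψ (w 0) *
        (if g + (b + c + 2) ≤ n ∧ StartsWithPattern b c (dropSeq g w)
            then occWeight s b c (n - (g + 1)) (dropSeq (g + 1) w) else 0) else 0)
      = patternSum s b c K (chainSteps (riseExcept b) g ψ) (n - g) := by
  have hbg : b < g := lt_of_le_of_lt (le_max_left _ _) hg
  by_cases hgn : g + (b + c + 2) ≤ n
  swap
  · rw [patternSum_of_lt _ _ _ _ _ (by omega)]
    simp [hgn, wordSum]
  obtain ⟨r, rfl⟩ : ∃ r, n = g + r + 1 := ⟨n - g - 1, by omega⟩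
  have h := wordSum_chain K r (riseExcept b) ψ g fun v => if StartsWithPattern b c v then
    occWeight s b c r (dropSeq 1 v) else 0
  rw [show g + r + 1 - g = r + 1 by omega, patternSum]
  refine Eq.trans ?_ (h.trans ?_)
  -- The exchanged positions are below `g + 1`, so the remaining weight is unaffected.
  · rw [← wordSum_comp_swap K (b := b) (by omega)]
    refine wordSum_congr fun w _ => ?_
    have h1 := startsWithPattern_overlap hb hc hbc hg hg' w
    rw [dropSeq_comp_swap (g := g + 1) (by omega), Function.comp_apply,
      swap_succ_of_lt (show 0 < b by omega), dropSeq_dropSeq,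
      show g + r + 1 - (g + 1) = r by omega]
    by_cases h2 : IsLetterChain (riseExcept b) g w ∧ StartsWithPattern b c (dropSeq g w)
    · rw [if_pos (h1.2 h2).1, if_pos ⟨hgn, (h1.2 h2).2⟩, if_pos h2.1, if_pos h2.2]
    · have h3 := not_and_or.1 (mt h1.1 h2)
      rw [not_and_or] at h2
      have h4 : (if StartsWithPattern b c (w ∘ Equiv.swap b (b + 1)) then ψ (w 0) *
          (if g + (b + c + 2) ≤ g + r + 1
              ∧ StartsWithPattern b c (dropSeq g (w ∘ Equiv.swap b (b + 1)))
            then occWeight s b c r (dropSeq (g + 1) w) else 0) else 0) = 0 := by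
        rcases h3 with h3 | h3
        · rw [if_neg h3]
        · simp only [h3, and_false, if_false, mul_zero, ite_self]
      rw [h4]
      rcases h2 with h2 | h2
      · rw [if_neg h2]
      · rw [if_neg h2, mul_zero, ite_self]
  · refine wordSum_congr fun w _ => ?_
    simp only [Nat.add_sub_cancel, (by omega : b + c + 2 ≤ r + 1), true_and]
    split_ifs <;> simp

theorem patternSum_add (s : R) {b c : ℕ} (K : ℕ) (hb : 1 ≤ b) (hc : 1 ≤ c)
    (hbc : 3 ≤ b + c) (ψ : ℕ → R) (r : ℕ) :
    patternSum s b c K ψ (b + c + 2 + r)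
      = (∑ x ∈ Finset.range K, chainSteps (riseExcept b) (b + c + 1) ψ x) * occSum s b c K r
        + (s - 1) * ∑ g ∈ Finset.Ico (max b c + 1) (b + c + 2),
            patternSum s b c K (chainSteps (riseExcept b) g ψ) (b + c + 2 + r - g) := by
  have hmax : max b c < b + c + 2 := by
    rw [max_lt_iff]; omega
  rw [← patternSum_leading s b c K hb]
  have h1 : ∀ g ∈ Finset.Ico (max b c + 1) (b + c + 2),
      patternSum s b c K (chainSteps (riseExcept b) g ψ) (b + c + 2 + r - g) = _ := fun g hg =>
    (patternSum_overlap s K hb hc hbc (by have := Finset.mem_Ico.1 hg; omega)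
      (Finset.mem_Ico.1 hg).2 ψ (b + c + 2 + r) (by omega)).symm
  rw [Finset.sum_congr rfl h1, ← wordSum_sum, ← wordSum_mul_left, ← wordSum_add, patternSum]
  refine wordSum_congr fun w _ => ?_
  simp only [(by omega : b + c + 2 ≤ b + c + 2 + r), true_and]
  by_cases hw : StartsWithPattern b c w
  · simp only [if_pos hw]
    rw [occWeight_telescope s b c _ w (show 1 ≤ b + c + 2 by omega) (by omega), mul_add,
      Nat.add_sub_cancel_left, ← Finset.mul_sum, mul_left_comm (s - 1)]
    congr 3
    -- The distances up to `max b c` drop out, since no two occurrences are that close.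
    refine (Finset.sum_subset (Finset.Ico_subset_Ico_left (by omega)) fun g hg hg' => ?_).symm
    rw [Finset.mem_Ico] at hg hg'
    exact if_neg fun h => hw.not_dropSeq hg.1 (by omega) h.2
  · simp [hw]

end

/-! ### The generating function of the weighted words -/

section
variable {R : Type*} [CommRing R]

/-- The generating function of `occSum` for words in `2 * k` letters. -/
noncomputable def occSeries (s : R) (b c k : ℕ) : PowerSeries R :=
  PowerSeries.mk fun n => occSum s b c (2 * k) n

/-- The generating function of `patternSum` for words in `2 * k` letters. -/
noncomputable def patternSeries (s : R) (b c k : ℕ) (ψ : ℕ → R) : PowerSeries R :=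
  PowerSeries.mk fun n => patternSum s b c (2 * k) ψ n

theorem occSeries_eq (s : R) (b c k : ℕ) :
    occSeries s b c k = 1 + PowerSeries.C (2 * k : R) * PowerSeries.X * occSeries s b c k
      + PowerSeries.C (s - 1) * patternSeries s b c k fun _ => 1 := by
  refine PowerSeries.ext fun n => ?_
  cases n with
  | zero =>
    rw [map_add, map_add, mul_right_comm, PowerSeries.coeff_zero_mul_X, PowerSeries.coeff_C_mul]
    simp [occSeries, occSum_zero, patternSeries, patternSum_of_lt]
  | succ n =>
    rw [map_add, map_add, mul_right_comm, PowerSeries.coeff_succ_mul_X, PowerSeries.coeff_C_mul,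
      PowerSeries.coeff_C_mul]
    simp [occSeries, patternSeries, occSum_succ, PowerSeries.coeff_one]

theorem patternSeries_eq (s : R) {b c : ℕ} (k : ℕ) (hb : 1 ≤ b) (hc : 1 ≤ c)
    (hbc : 3 ≤ b + c) (ψ : ℕ → R) :
    patternSeries s b c k ψ
      = PowerSeries.X ^ (b + c + 2) * (PowerSeries.C (∑ x ∈ Finset.range (2 * k),
          chainSteps (riseExcept b) (b + c + 1) ψ x) * occSeries s b c k)
        + ∑ g ∈ Finset.Ico (max b c + 1) (b + c + 2), PowerSeries.X ^ g *
          (PowerSeries.C (s - 1) * patternSeries s b c k (chainSteps (riseExcept b) g ψ)) := by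
  refine PowerSeries.ext fun n => ?_
  rw [map_add, map_sum (PowerSeries.coeff n)]
  simp only [PowerSeries.coeff_X_pow_mul', PowerSeries.coeff_C_mul]
  simp only [patternSeries, occSeries, PowerSeries.coeff_mk]
  by_cases hn : b + c + 2 ≤ n
  · obtain ⟨r, rfl⟩ := Nat.exists_eq_add_of_le hn
    rw [patternSum_add s _ hb hc hbc, if_pos hn, Nat.add_sub_cancel_left, Finset.mul_sum]
    congr 1
    refine Finset.sum_congr rfl fun g hg => ?_
    rw [if_pos (by have := (Finset.mem_Ico.1 hg).2; omega)]
  · rw [if_neg hn, patternSum_of_lt _ _ _ _ _ (by omega), zero_add]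
    refine (Finset.sum_eq_zero fun g hg => ?_).symm
    rw [patternSum_of_lt _ _ _ _ _ (by omega), mul_zero, ite_self]

/-- The generating function of the chains of overlapping occurrences of the pattern. -/
noncomputable def overlapSeries (s : R) (b c : ℕ) : SeriesTX R :=
  uSer R * ySer R ^ (b + c + 1) * xVar R ^ (b + c + 2) *
    (1 - (PowerSeries.C (PowerSeries.C s) - 1) * uSer R *
      ∑ g ∈ Finset.Ico (max b c + 1) (b + c + 2), zSer R ^ g)⁻¹ʳ

theorem constantCoeff_uSer : PowerSeries.constantCoeff (uSer R) = 0 := by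
  simp [uSer, tVar]

theorem isUnit_overlap_denominator (v w : SeriesTX R) : IsUnit (1 - v * uSer R * w) := by
  rw [PowerSeries.isUnit_iff_constantCoeff]; simp [constantCoeff_uSer]

theorem overlapSeries_eq (s : R) (b c : ℕ) :
    overlapSeries s b c = uSer R * ySer R ^ (b + c + 1) * xVar R ^ (b + c + 2)
      + ∑ g ∈ Finset.Ico (max b c + 1) (b + c + 2), (PowerSeries.C (PowerSeries.C s) - 1) *
        (uSer R * ySer R ^ g * overlapSeries s b c * xVar R ^ g) := by
  have h : overlapSeries s b c * (1 - (PowerSeries.C (PowerSeries.C s) - 1) * uSer R *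
      ∑ g ∈ Finset.Ico (max b c + 1) (b + c + 2), zSer R ^ g)
      = uSer R * ySer R ^ (b + c + 1) * xVar R ^ (b + c + 2) := by
    rw [overlapSeries, Ring.inverse_mul_cancel_right _ _ (isUnit_overlap_denominator _ _)]
  have h2 : ∑ g ∈ Finset.Ico (max b c + 1) (b + c + 2), (PowerSeries.C (PowerSeries.C s) - 1) *
        (uSer R * ySer R ^ g * overlapSeries s b c * xVar R ^ g)
      = (PowerSeries.C (PowerSeries.C s) - 1) * uSer R * overlapSeries s b c *
        ∑ g ∈ Finset.Ico (max b c + 1) (b + c + 2), zSer R ^ g := by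
    rw [Finset.mul_sum]
    refine Finset.sum_congr rfl fun g _ => ?_
    rw [zSer_eq]; ring
  rw [h2]
  linear_combination h

theorem coeff_mul_xVar_pow (k n : ℕ) (f : SeriesTX R) :
    PowerSeries.coeff k (f * xVar R ^ n) = PowerSeries.coeff k f * PowerSeries.X ^ n := by
  rw [xVar, ← map_pow, PowerSeries.coeff_mul_C]

/-- The geometric series satisfies a recursion in which each factor `u * y ^ g` is read backwards as
the action of a chain on `ψ`; it thereby takes the form of `patternSeries_eq`. -/
theorem coeff_evenSeries_mul_overlapSeries (s : R) {b c : ℕ} (k : ℕ) (hb : 1 ≤ b) (ψ : ℕ → R) :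
    PowerSeries.coeff k (evenSeries ψ * overlapSeries s b c)
      = PowerSeries.X ^ (b + c + 2) * PowerSeries.C (∑ x ∈ Finset.range (2 * k),
          chainSteps (riseExcept b) (b + c + 1) ψ x)
        + ∑ g ∈ Finset.Ico (max b c + 1) (b + c + 2), PowerSeries.X ^ g *
          (PowerSeries.C (s - 1) * PowerSeries.coeff k
            (evenSeries (chainSteps (riseExcept b) g ψ) * overlapSeries s b c)) := by
  have h : evenSeries ψ * overlapSeries s b c
      = evenSeries (chainSteps (riseExcept b) (b + c + 1) ψ) * xVar R ^ (b + c + 2)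
        + ∑ g ∈ Finset.Ico (max b c + 1) (b + c + 2), PowerSeries.C (PowerSeries.C (s - 1)) *
          (evenSeries (chainSteps (riseExcept b) g ψ) * overlapSeries s b c * xVar R ^ g) := by
    conv_lhs => rw [overlapSeries_eq, mul_add, Finset.mul_sum]
    congr 1
    · rw [evenSeries_chainSteps_riseExcept hb (by omega)]; ring
    · refine Finset.sum_congr rfl fun g hg => ?_
      rw [evenSeries_chainSteps_riseExcept hb (by have := (Finset.mem_Ico.1 hg).1; omega),
        map_sub, map_sub, map_one, map_one]
      ring
  rw [h, map_add, map_sum (PowerSeries.coeff k), coeff_mul_xVar_pow, mul_comm]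
  congr 1
  · simp [evenSeries]
  · refine Finset.sum_congr rfl fun g _ => ?_
    rw [PowerSeries.coeff_C_mul, coeff_mul_xVar_pow]; ring

theorem eq_zero_of_forall_X_pow_dvd {f : PowerSeries R} (h : ∀ n, PowerSeries.X ^ n ∣ f) :
    f = 0 := by
  refine PowerSeries.ext fun n => ?_
  exact PowerSeries.X_pow_dvd_iff.1 (h (n + 1)) n (by omega)

/-- Both sides obey the same recursion in `ψ`, and every `g` in it is positive. The difference, for
all `ψ` at once, is thus divisible by arbitrarily high powers of `X`. -/
theorem patternSeries_eq_mul (s : R) {b c : ℕ} (k : ℕ) (hb : 1 ≤ b) (hc : 1 ≤ c)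
    (hbc : 3 ≤ b + c) (ψ : ℕ → R) :
    patternSeries s b c k ψ
      = PowerSeries.coeff k (evenSeries ψ * overlapSeries s b c) * occSeries s b c k := by
  rw [← sub_eq_zero]
  refine eq_zero_of_forall_X_pow_dvd fun n => ?_
  induction n generalizing ψ with
  | zero => simp
  | succ n ih =>
    have h : patternSeries s b c k ψ
        - PowerSeries.coeff k (evenSeries ψ * overlapSeries s b c) * occSeries s b c k
        = ∑ g ∈ Finset.Ico (max b c + 1) (b + c + 2), PowerSeries.X ^ g * (PowerSeries.C (s - 1) *
          (patternSeries s b c k (chainSteps (riseExcept b) g ψ) - PowerSeries.coeff k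
            (evenSeries (chainSteps (riseExcept b) g ψ) * overlapSeries s b c)
              * occSeries s b c k)) := by
      rw [patternSeries_eq s k hb hc hbc, coeff_evenSeries_mul_overlapSeries s k hb, add_mul,
        Finset.sum_mul, mul_assoc, add_sub_add_left_eq_sub, ← Finset.sum_sub_distrib]
      refine Finset.sum_congr rfl fun g _ => ?_
      ring
    rw [h]
    refine Finset.dvd_sum fun g hg => ?_
    rw [add_comm, pow_add]
    refine mul_dvd_mul (pow_dvd_pow _ ?_) (Dvd.dvd.mul_left (ih _) _)
    have := (Finset.mem_Ico.1 hg).1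
    omega

theorem occSeries_mul_eq_one (s : R) {b c : ℕ} (k : ℕ) (hb : 1 ≤ b) (hc : 1 ≤ c)
    (hbc : 3 ≤ b + c) :
    (1 - PowerSeries.coeff k (evenSeries (fun _ => (1 : R)) * (xVar R
      + (PowerSeries.C (PowerSeries.C s) - 1) * overlapSeries s b c))) * occSeries s b c k = 1 := by
  have h1 := occSeries_eq s b c k
  rw [patternSeries_eq_mul s k hb hc hbc] at h1
  have h2 : PowerSeries.coeff k (evenSeries (fun _ => (1 : R)) * (xVar R
      + (PowerSeries.C (PowerSeries.C s) - 1) * overlapSeries s b c))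
      = PowerSeries.C (2 * k : R) * PowerSeries.X + PowerSeries.C (s - 1) *
        PowerSeries.coeff k (evenSeries (fun _ => (1 : R)) * overlapSeries s b c) := by
    rw [mul_add, map_add, mul_left_comm,
      show (PowerSeries.C (PowerSeries.C s) - 1 : SeriesTX R)
        = PowerSeries.C (PowerSeries.C (s - 1)) by simp, PowerSeries.coeff_C_mul]
    congr 1
    have := coeff_mul_xVar_pow k 1 (evenSeries fun _ => (1 : R))
    rw [pow_one, pow_one] at this
    rw [this]
    simp [evenSeries]
  rw [h2]
  linear_combination h1

end

/-! ### Standardization of words -/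

/-- The key by which the letters of a word are sorted: equal odd letters are sorted from left to
right, and equal even letters from right to left. -/
def letterKey (w : ℕ → ℕ) (p : ℕ) : ℕ ×ₗ ℤ :=
  toLex (w p, if (w p).bodd then (p : ℤ) else -p)

theorem letterKey_injective (w : ℕ → ℕ) : Function.Injective (letterKey w) := by
  intro p q h
  have h1 := congrArg (fun x => (ofLex x).1) h
  have h2 := congrArg (fun x => (ofLex x).2) h
  simp only [letterKey, ofLex_toLex] at h1 h2
  rw [h1] at h2
  split_ifs at h2 <;> omega

theorem letterKey_lt_iff_of_lt (w : ℕ → ℕ) {p q : ℕ} (h : p < q) :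
    letterKey w p < letterKey w q ↔ letterRel true (w p) (w q) := by
  rw [letterKey, letterKey, Prod.Lex.toLex_lt_toLex, letterRel]
  refine or_congr Iff.rfl (and_congr_right fun h1 => ?_)
  simp only at h1
  rw [h1]
  cases (w q).bodd <;> simp <;> omega

theorem letterKey_lt_iff_of_gt (w : ℕ → ℕ) {p q : ℕ} (h : q < p) :
    letterKey w p < letterKey w q ↔ letterRel false (w p) (w q) := by
  rw [letterKey, letterKey, Prod.Lex.toLex_lt_toLex, letterRel]
  refine or_congr Iff.rfl (and_congr_right fun h1 => ?_)
  simp only at h1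
  rw [h1]
  cases (w q).bodd <;> simp <;> omega

/-- Comparing consecutive values of `σ` suffices, by transitivity. This is what turns order
conditions into chains. -/
theorem forall_perm_lt_iff {α : Type*} [LinearOrder α] {n : ℕ} (f : Fin n → α)
    (σ : Equiv.Perm (Fin n)) :
    (∀ p q, σ p < σ q ↔ f p < f q)
      ↔ ∀ j (h : j + 1 < n), f (σ⁻¹ ⟨j, by omega⟩) < f (σ⁻¹ ⟨j + 1, h⟩) := by
  constructor
  · intro h j hj
    rw [← h]
    simp
  · intro h
    have hmono : StrictMono (f ∘ (σ⁻¹ : Equiv.Perm (Fin n))) := by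
      cases n with
      | zero => intro p; exact p.elim0
      | succ n =>
        rw [Fin.strictMono_iff_lt_succ]
        intro i
        exact h i (by omega)
    intro p q
    have := hmono.lt_iff_lt (a := σ p) (b := σ q)
    simpa using this.symm

theorem stdWord_lt_iff {m n : ℕ} (w : Fin m → Fin n) (j k : Fin m) :
    stdWord w j < stdWord w k ↔ w j < w k := by
  constructor
  · intro h
    by_contra h'
    refine h.not_ge (Finset.card_le_card fun l hl => ?_)
    rw [Finset.mem_filter] at hl ⊢
    exact ⟨hl.1, hl.2.trans_le (not_lt.1 h')⟩
  · intro h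
    refine Finset.card_lt_card ((Finset.ssubset_iff_of_subset fun l hl => ?_).2 ⟨j, ?_, ?_⟩)
    · rw [Finset.mem_filter] at hl ⊢
      exact ⟨hl.1, hl.2.trans h⟩
    · simp [h]
    · simp

theorem stdWord_eq_iff {m n : ℕ} (w : Fin m → Fin n) (σ : Equiv.Perm (Fin m)) :
    (stdWord w = fun j => (σ j : ℕ)) ↔ ∀ j k, σ j < σ k ↔ w j < w k := by
  constructor
  · intro h j k
    rw [← stdWord_lt_iff w, h, Fin.lt_def]
  · intro h
    funext j
    have h1 : (Finset.univ.filter fun k => w k < w j)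
        = (Finset.univ.filter fun l => l < σ j).map σ.symm.toEmbedding := by
      ext k
      simp [h]
    rw [stdWord, h1, Finset.card_map, Finset.filter_gt_eq_Iio, Fin.card_Iio]

/-- `π` is the standardization of the first `n` letters of `w`. -/
def IsStandardization {n : ℕ} (π : Equiv.Perm (Fin n)) (w : ℕ → ℕ) : Prop :=
  ∀ p q : Fin n, π p < π q ↔ letterKey w p < letterKey w q

theorem existsUnique_isStandardization (n : ℕ) (w : ℕ → ℕ) :
    ∃! π : Equiv.Perm (Fin n), IsStandardization π w := by
  let f : Fin n → ℕ ×ₗ ℤ := fun p => letterKey w p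
  have hf : Function.Injective f := fun p q h => Fin.ext (letterKey_injective w h)
  have hmono : StrictMono (f ∘ Tuple.sort f) :=
    (Tuple.monotone_sort f).strictMono_of_injective (hf.comp (Tuple.sort f).injective)
  refine ⟨(Tuple.sort f)⁻¹, fun p q => ?_, fun π hπ => ?_⟩
  · have := hmono.lt_iff_lt (a := (Tuple.sort f)⁻¹ p) (b := (Tuple.sort f)⁻¹ q)
    simpa [f] using this.symm
  · have h1 : ∀ j k, π (Tuple.sort f j) < π (Tuple.sort f k) ↔ j < k := fun j k =>
      (hπ _ _).trans hmono.lt_iff_lt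
    have h2 : StrictMono (π * Tuple.sort f) := fun j k h => (h1 j k).2 h
    -- A strictly increasing permutation of `Fin n` is an order automorphism, hence the identity.
    rw [← mul_eq_one_iff_eq_inv]
    ext j
    have := congrFun (Subsingleton.elim
      (h2.orderIsoOfSurjective _ (π * Tuple.sort f).surjective : Fin n ≃o Fin n)
      (OrderIso.refl _) ▸ rfl :
      (h2.orderIsoOfSurjective _ (π * Tuple.sort f).surjective : Fin n → Fin n) = id) j
    exact congrArg Fin.val this

theorem swap_fin_val {m b : ℕ} (hb : b + 1 < m) (j : Fin m) :
    (Equiv.swap (⟨b, by omega⟩ : Fin m) ⟨b + 1, hb⟩ j : ℕ) = Equiv.swap b (b + 1) j := by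
  simp only [Equiv.swap_apply_def, Fin.ext_iff]
  split_ifs <;> rfl

theorem stdWord_eq_swap_iff {m n b c : ℕ} (hm : m = b + c + 2) {π : Equiv.Perm (Fin n)}
    {w : ℕ → ℕ} (h : IsStandardization π w) {i : ℕ} (hi : i + m ≤ n) :
    (stdWord (fun j : Fin m => π ⟨i + j, by omega⟩)
      = fun j => (Equiv.swap (⟨b, by omega⟩ : Fin m) ⟨b + 1, by omega⟩ j : ℕ))
      ↔ StartsWithPattern b c (dropSeq i w) := by
  rw [stdWord_eq_iff]
  simp only [h _ _]
  rw [forall_perm_lt_iff (fun j : Fin m => letterKey w (i + j)), Equiv.swap_inv]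
  simp only [swap_fin_val (show b + 1 < m by omega)]
  unfold StartsWithPattern IsLetterChain
  refine forall_congr' fun j => ?_
  have hj : j + 1 < m ↔ j < b + c + 1 := by omega
  rw [hj]
  refine forall_congr' fun _ => ?_
  simp only [Function.comp_apply, dropSeq]
  by_cases hjb : j = b
  · subst hjb
    rw [riseExcept_self, letterKey_lt_iff_of_gt]
    simp
  · rw [riseExcept_of_ne hjb, letterKey_lt_iff_of_lt]
    rw [Equiv.swap_apply_def, Equiv.swap_apply_def]
    split_ifs <;> omega

section
variable {R : Type*} [CommRing R]

theorem occWeight_eq_pow_occ (s : R) {m n b c : ℕ} (hm : m = b + c + 2) {π : Equiv.Perm (Fin n)}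
    {w : ℕ → ℕ} (h : IsStandardization π w) :
    occWeight s b c n w
      = s ^ occ (Equiv.swap (⟨b, by omega⟩ : Fin m) ⟨b + 1, by omega⟩) π := by
  unfold occWeight occFactor occ
  rw [Finset.prod_ite, Finset.prod_const, Finset.prod_const_one, mul_one]
  congr 2
  ext i
  simp only [Finset.mem_filter, Finset.mem_range]
  constructor
  · rintro ⟨h1, h2, h3⟩
    exact ⟨by omega, by omega, (stdWord_eq_swap_iff hm h (by omega)).2 h3⟩
  · rintro ⟨h1, h2, h3⟩
    exact ⟨by omega, by omega, (stdWord_eq_swap_iff hm h (by omega)).1 h3⟩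

/-! ### Counting the words with a given standardization -/

/-- The positions at which a permutation rises. -/
def rises {n : ℕ} (ρ : Equiv.Perm (Fin n)) : ℕ → Bool :=
  fun j => decide (∃ h : j + 1 < n, ρ ⟨j, by omega⟩ < ρ ⟨j + 1, h⟩)

theorem rises_eq_true_iff {n : ℕ} (ρ : Equiv.Perm (Fin n)) {j : ℕ} (h : j + 1 < n) :
    rises ρ j = true ↔ ρ ⟨j, by omega⟩ < ρ ⟨j + 1, h⟩ := by
  simp [rises, h]

theorem rises_eq_false_iff {n : ℕ} (ρ : Equiv.Perm (Fin n)) {j : ℕ} (h : j + 1 < n) :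
    rises ρ j = false ↔ ρ ⟨j + 1, h⟩ < ρ ⟨j, by omega⟩ := by
  rw [← Bool.not_eq_true, rises_eq_true_iff ρ h, not_lt]
  refine ⟨fun h1 => lt_of_le_of_ne h1 fun h2 => ?_, le_of_lt⟩
  have := congrArg Fin.val (ρ.injective h2)
  simp at this

theorem chainPeaks_rises {n : ℕ} (ρ : Equiv.Perm (Fin n)) :
    chainPeaks (rises ρ) (n - 1) = peakNumber ρ := by
  unfold chainPeaks peakNumber
  symm
  refine Finset.card_bij (fun i _ => (i : ℕ)) (fun i hi => ?_) (fun i _ j _ h => Fin.ext h)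
    fun j hj => ?_
  · simp only [Finset.mem_filter, Finset.mem_univ, true_and] at hi
    obtain ⟨h0, h1, h2, h3⟩ := hi
    rw [Finset.mem_filter, Finset.mem_range, rises_eq_true_iff ρ (by omega),
      rises_eq_false_iff ρ h1]
    refine ⟨by omega, h0, ?_, h3⟩
    convert h2 using 3
    omega
  · rw [Finset.mem_filter, Finset.mem_range] at hj
    obtain ⟨h0, h1, h2, h3⟩ := hj
    rw [rises_eq_true_iff ρ (by omega)] at h2
    rw [rises_eq_false_iff ρ (by omega)] at h3
    refine ⟨⟨j, by omega⟩, ?_, rfl⟩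
    simp only [Finset.mem_filter, Finset.mem_univ, true_and]
    refine ⟨h1, by omega, ?_, h3⟩
    convert h2 using 3
    omega

-- Rearranging the letters by `π` lists them in increasing order of their keys. Consecutive ones
-- stand from left to right exactly at the rises of `π⁻¹`, which decides whether equality is allowed
-- at odd or at even letters.
open Classical in
theorem wordSum_isStandardization (K n : ℕ) (π : Equiv.Perm (Fin (n + 1))) :
    wordSum K (n + 1) (fun w => if IsStandardization π w then (1 : R) else 0)
      = ∑ x ∈ Finset.range K, chainSteps (rises π⁻¹) n (fun _ => 1) x := by
  let τ' : ℕ → ℕ := fun j => if h : j < n + 1 then π ⟨j, h⟩ else j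
  have hτ : ∀ j : Fin (n + 1), τ' j = π j := fun j => dif_pos j.2
  have hτ' : ∀ j, n + 1 ≤ j → τ' j = j := fun j hj => dif_neg hj.not_gt
  have h1 := wordSum_head_mul K 0 (chainSteps (rises π⁻¹) n fun _ => (1 : R)) fun _ => 1
  rw [wordSum_zero, mul_one] at h1
  have h2 := wordSum_chain K 0 (rises π⁻¹) (fun _ => (1 : R)) n fun _ => 1
  rw [add_zero] at h2
  rw [← h1, ← h2,
    ← wordSum_comp_perm K (n + 1) _ π τ' hτ (fun j hj => hj.trans_eq (hτ' j hj).symm)]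
  refine wordSum_congr fun w _ => ?_
  have h3 : IsStandardization π (w ∘ τ') ↔ IsLetterChain (rises π⁻¹) n w := by
    unfold IsStandardization IsLetterChain
    rw [forall_perm_lt_iff fun p : Fin (n + 1) => letterKey (w ∘ τ') p]
    refine forall_congr' fun j => ?_
    suffices key : ∀ hj : j + 1 < n + 1,
        (letterKey (w ∘ τ') (π⁻¹ ⟨j, by omega⟩ : Fin (n + 1))
            < letterKey (w ∘ τ') (π⁻¹ ⟨j + 1, hj⟩ : Fin (n + 1)))
          ↔ letterRel (rises π⁻¹ j) (w j) (w (j + 1)) from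
      ⟨fun h hj => (key (by omega)).1 (h _), fun h hj => (key hj).2 (h (by omega))⟩
    intro hj
    have e1 : (w ∘ τ') (π⁻¹ ⟨j, by omega⟩ : Fin (n + 1)) = w j := by
      rw [Function.comp_apply, hτ]; simp
    have e2 : (w ∘ τ') (π⁻¹ ⟨j + 1, by omega⟩ : Fin (n + 1)) = w (j + 1) := by
      rw [Function.comp_apply, hτ]; simp
    cases hr : rises π⁻¹ j with
    | true =>
      rw [rises_eq_true_iff _ (by omega)] at hr
      rw [letterKey_lt_iff_of_lt _ hr, e1, e2]
    | false =>
      rw [rises_eq_false_iff _ (by omega)] at hr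
      rw [letterKey_lt_iff_of_gt _ hr, e1, e2]
  simp only [h3, mul_one]

theorem occSum_eq_sum_perm (s : R) {m b c : ℕ} (hm : m = b + c + 2) (K n : ℕ) :
    occSum s b c K (n + 1) = ∑ π : Equiv.Perm (Fin (n + 1)),
      s ^ occ (Equiv.swap (⟨b, by omega⟩ : Fin m) ⟨b + 1, by omega⟩) π *
        ∑ x ∈ Finset.range K, chainSteps (rises π⁻¹) n (fun _ => (1 : R)) x := by
  classical
  simp only [← wordSum_isStandardization, ← wordSum_mul_left]
  rw [← wordSum_sum, occSum]
  refine wordSum_congr fun w _ => ?_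
  obtain ⟨π, hπ, huniq⟩ := existsUnique_isStandardization (n + 1) w
  rw [Finset.sum_eq_single π, if_pos hπ, mul_one, occWeight_eq_pow_occ s hm hπ]
  · intro π' _ hne
    rw [if_neg fun h => hne (huniq _ h), mul_zero]
  · simp

/-! ### From inverse peak polynomials to weighted words -/

/-- `(1 + t) / (2 (1 - t))`. -/
noncomputable def halfSer (R : Type*) [CommRing R] : SeriesTX R :=
  (1 + tVar R) * (2 * (1 - tVar R))⁻¹ʳ

theorem isUnit_two_mul (h : IsUnit (2 : R)) : IsUnit (2 * (1 - tVar R)) := by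
  refine IsUnit.mul ?_ isUnit_one_sub_tVar
  have := (h.map (PowerSeries.C (R := R))).map (PowerSeries.C (R := PowerSeries R))
  rwa [map_ofNat, map_ofNat] at this

theorem two_mul_halfSer (h : IsUnit (2 : R)) :
    2 * (1 - tVar R) * halfSer R = 1 + tVar R := by
  rw [halfSer, mul_left_comm, Ring.mul_inverse_cancel _ (isUnit_two_mul h), mul_one]

theorem halfSer_mul_uSer_mul_ySer (h : IsUnit (2 : R)) :
    halfSer R * uSer R * ySer R = evenSeries fun _ => 1 := by
  refine ((isUnit_two_mul h).mul isUnit_one_sub_tVar).mul_left_cancel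
    (b := halfSer R * uSer R * ySer R) ?_
  linear_combination uSer R * ySer R * (1 - tVar R) * two_mul_halfSer h
    + (1 + tVar R) * uSer R * one_sub_tVar_mul_ySer (R := R) + one_add_tVar_sq_mul_uSer (R := R)
    - 2 * one_sub_tVar_sq_mul_evenSeries_one (R := R)

theorem coeff_halfSer_mul_ipkPoly (h : IsUnit (2 : R)) (s : R) {m b c : ℕ} (hm : m = b + c + 2)
    (k n : ℕ) :
    PowerSeries.coeff k (halfSer R * (ipkPoly (Equiv.swap (⟨b, by omega⟩ : Fin m)
        ⟨b + 1, by omega⟩) (n + 1) (PowerSeries.C (PowerSeries.C s)) (uSer R) * zSer R ^ (n + 1)))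
      = PowerSeries.C (occSum s b c (2 * k) (n + 1)) * PowerSeries.X ^ (n + 1) := by
  rw [zSer_eq, mul_pow, ← mul_assoc, ← mul_assoc, coeff_mul_xVar_pow]
  congr 1
  rw [ipkPoly, if_neg (by omega), Finset.mul_sum, Finset.sum_mul, map_sum,
    occSum_eq_sum_perm s hm, map_sum]
  refine Finset.sum_congr rfl fun π _ => ?_
  have h1 : halfSer R * (PowerSeries.C (PowerSeries.C s) ^
      occ (Equiv.swap (⟨b, by omega⟩ : Fin m) ⟨b + 1, by omega⟩) π * uSer R ^ (ipk π + 1))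
        * ySer R ^ (n + 1)
      = PowerSeries.C (PowerSeries.C
          (s ^ occ (Equiv.swap (⟨b, by omega⟩ : Fin m) ⟨b + 1, by omega⟩) π))
        * evenSeries (chainSteps (rises π⁻¹) n fun _ => (1 : R)) := by
    have h2 := chainPeaks_rises π⁻¹
    rw [Nat.add_sub_cancel] at h2
    rw [evenSeries_chainSteps_one, h2, ipk, ← halfSer_mul_uSer_mul_ySer h, map_pow, map_pow]
    ring
  rw [h1, PowerSeries.coeff_C_mul, map_mul]
  simp [evenSeries]

end

/-! ### Formal sums -/

section
variable {R : Type*} [CommRing R]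

theorem coeffTX_eq_zero_of_xVar_pow_dvd {f : SeriesTX R} {n j : ℕ} (h : xVar R ^ n ∣ f)
    (hj : j < n) (i : ℕ) : coeffTX i j f = 0 := by
  obtain ⟨g, rfl⟩ := h
  rw [coeffTX, mul_comm, coeff_mul_xVar_pow, PowerSeries.coeff_mul_X_pow', if_neg (by omega)]

theorem formallySummable_of_xVar_pow_dvd {f : ℕ → SeriesTX R} (h : ∀ n, xVar R ^ n ∣ f n) :
    FormallySummable f := by
  intro i j
  refine (Set.finite_Iic j).subset fun n hn => ?_
  by_contra hlt
  exact hn (coeffTX_eq_zero_of_xVar_pow_dvd (h n) (not_le.1 hlt) i)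

theorem coeffTX_formalSum (f : ℕ → SeriesTX R) (i j : ℕ) :
    coeffTX i j (formalSum f) = ∑ᶠ n, coeffTX i j (f n) := by
  simp [coeffTX, formalSum]

theorem coeffTX_mul (i j : ℕ) (f g : SeriesTX R) :
    coeffTX i j (f * g) = ∑ p ∈ Finset.HasAntidiagonal.antidiagonal i, ∑ q ∈ Finset.HasAntidiagonal.antidiagonal j,
      coeffTX p.1 q.1 f * coeffTX p.2 q.2 g := by
  simp only [coeffTX, PowerSeries.coeff_mul, map_sum]

theorem formalSum_mul_left {f : ℕ → SeriesTX R} (hf : FormallySummable f) (a : SeriesTX R) :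
    a * formalSum f = formalSum fun n => a * f n := by
  refine PowerSeries.ext fun i => PowerSeries.ext fun j => ?_
  change coeffTX i j _ = coeffTX i j _
  have hsupp : ∀ p q : ℕ × ℕ, (Function.support fun n =>
      coeffTX p.1 q.1 a * coeffTX p.2 q.2 (f n)).Finite := fun p q =>
    (hf p.2 q.2).subset fun n hn h => hn (by simp [h])
  rw [coeffTX_formalSum, coeffTX_mul]
  simp only [coeffTX_mul, coeffTX_formalSum]
  rw [finsum_sum_comm]
  · refine Finset.sum_congr rfl fun p _ => ?_
    rw [finsum_sum_comm _ _ fun q _ => hsupp p q]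
    refine Finset.sum_congr rfl fun q _ => ?_
    exact mul_finsum' _ _ (hf p.2 q.2)
  · intro p _
    refine (Set.Finite.biUnion (Finset.HasAntidiagonal.antidiagonal j).finite_toSet
      fun q _ => hsupp p q).subset fun n hn => ?_
    obtain ⟨q, hq, hne⟩ := Finset.exists_ne_zero_of_sum_ne_zero hn
    exact Set.mem_biUnion hq hne

/-! ### Coefficients of sums of Hadamard powers -/

theorem coeff_hadamardPow (f : SeriesTX R) (n k : ℕ) :
    PowerSeries.coeff k (hadamardPow f n) = PowerSeries.coeff k f ^ n := by
  induction n with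
  | zero => simp [hadamardPow]
  | succ n ih => simp [hadamardPow, hadamard, ih, pow_succ]

theorem X_pow_dvd_coeff_hadamardPow {f : SeriesTX R}
    (hf : ∀ k, PowerSeries.X ∣ PowerSeries.coeff k f) (n k : ℕ) :
    PowerSeries.X ^ n ∣ PowerSeries.coeff k (hadamardPow f n) := by
  rw [coeff_hadamardPow]; exact pow_dvd_pow_of_dvd (hf k) n

theorem coeffTX_hadamardPow_eq_zero {f : SeriesTX R}
    (hf : ∀ k, PowerSeries.X ∣ PowerSeries.coeff k f) {n j : ℕ} (hj : j < n) (k : ℕ) :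
    coeffTX k j (hadamardPow f n) = 0 :=
  PowerSeries.X_pow_dvd_iff.1 (X_pow_dvd_coeff_hadamardPow hf n k) j hj

theorem formallySummable_hadamardPow {f : SeriesTX R}
    (hf : ∀ k, PowerSeries.X ∣ PowerSeries.coeff k f) :
    FormallySummable fun n => hadamardPow f n := by
  intro i j
  refine (Set.finite_Iic j).subset fun n hn => ?_
  by_contra hlt
  exact hn (coeffTX_hadamardPow_eq_zero hf (not_le.1 hlt) i)

/-- Since `X` divides the coefficient of `t ^ k` in `f`, only the powers up to `j` matter, and the
finite geometric sum agrees with `g` up to a multiple of `X ^ (j + 1)`. -/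
theorem coeffTX_formalSum_hadamardPow {f : SeriesTX R}
    (hf : ∀ k, PowerSeries.X ∣ PowerSeries.coeff k f) {k : ℕ} {g : PowerSeries R}
    (hg : (1 - PowerSeries.coeff k f) * g = 1) (j : ℕ) :
    coeffTX k j (formalSum fun n => hadamardPow f n) = PowerSeries.coeff j g := by
  rw [coeffTX_formalSum, finsum_eq_finsetSum_of_support_subset (s := Finset.range (j + 1))]
  · have h1 : ∑ n ∈ Finset.range (j + 1), PowerSeries.coeff k f ^ n
        = g - PowerSeries.coeff k f ^ (j + 1) * g := by
      have := geom_sum_mul (PowerSeries.coeff k f) (j + 1)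
      linear_combination -g * this
        - (∑ n ∈ Finset.range (j + 1), PowerSeries.coeff k f ^ n) * hg
    simp only [coeffTX, coeff_hadamardPow, ← map_sum]
    rw [h1, map_sub, PowerSeries.X_pow_dvd_iff.1
      ((pow_dvd_pow_of_dvd (hf k) (j + 1)).mul_right g) j (by omega), sub_zero]
  · intro n hn
    rw [Finset.coe_range, Set.mem_Iio]
    by_contra hlt
    exact hn (coeffTX_hadamardPow_eq_zero hf (by omega) k)

/-! ### Inverse peaks and occurrences of a transposed identity pattern -/

theorem xVar_dvd_overlapSeries (s : R) (b c : ℕ) : xVar R ∣ overlapSeries s b c := by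
  unfold overlapSeries
  exact ((dvd_pow_self _ (by omega)).mul_left _).mul_right _

theorem X_dvd_coeff_of_xVar_dvd {f : SeriesTX R} (h : xVar R ∣ f) (k : ℕ) :
    PowerSeries.X ∣ PowerSeries.coeff k f := by
  obtain ⟨g, rfl⟩ := h
  rw [xVar, PowerSeries.coeff_C_mul]
  exact dvd_mul_right _ _

/-- The relations `hh`, `hE` and `hE'` are all that the computation uses about the series, so it
takes place in an arbitrary commutative ring. -/
theorem hadamard_base_aux {A : Type*} [CommRing A] {t x u y d v E h : A}
    (hu1 : IsUnit (2 * (1 - t))) (hu2 : IsUnit d) (hu3 : IsUnit ((1 - t) ^ 2))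
    (hh : 2 * (1 - t) * h = 1 + t) (hE : h * u * y = E) (hE' : (1 - t) ^ 2 * E = 2 * t)
    (p q : ℕ) :
    2 * t * x * ((1 - t) ^ 2)⁻¹ʳ
        + (1 + t) * v * u ^ 2 * (y ^ (p + 1) * x ^ q) * (2 * (1 - t) * d)⁻¹ʳ
      = E * (x + v * (u * y ^ p * x ^ q * d⁻¹ʳ)) := by
  have hd := Ring.mul_inverse_cancel _ hu2
  have hd2 := Ring.mul_inverse_cancel _ (hu1.mul hu2)
  have hx := Ring.mul_inverse_cancel _ hu3
  rw [mul_add]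
  congr 1
  · refine hu3.mul_left_cancel ?_
    linear_combination 2 * t * x * hx - x * hE'
  · refine (hu1.mul hu2).mul_left_cancel ?_
    linear_combination (1 + t) * v * u ^ 2 * y ^ (p + 1) * x ^ q * hd2
      - 2 * (1 - t) * E * v * u * y ^ p * x ^ q * hd
      + 2 * (1 - t) * v * u * y ^ p * x ^ q * hE
      - v * u ^ 2 * y ^ (p + 1) * x ^ q * hh

theorem hadamard_base_eq (h2 : IsUnit (2 : R)) (s : R) (b c : ℕ) :
    2 * tVar R * xVar R * ((1 - tVar R) ^ 2)⁻¹ʳ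
      + (1 + tVar R) * (PowerSeries.C (PowerSeries.C s) - 1) * uSer R ^ 2 * zSer R ^ (b + c + 2)
        * (2 * (1 - tVar R) * (1 - (PowerSeries.C (PowerSeries.C s) - 1) * uSer R *
          ∑ g ∈ Finset.Ico (max b c + 1) (b + c + 2), zSer R ^ g))⁻¹ʳ
      = evenSeries (fun _ => (1 : R)) * (xVar R
        + (PowerSeries.C (PowerSeries.C s) - 1) * overlapSeries s b c) := by
  rw [overlapSeries]
  have hu1 := isUnit_two_mul h2
  have hu2 := isUnit_overlap_denominator (PowerSeries.C (PowerSeries.C s) - 1)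
    (∑ g ∈ Finset.Ico (max b c + 1) (b + c + 2), zSer R ^ g)
  have hu3 := isUnit_one_sub_tVar (R := R).pow 2
  rw [show zSer R ^ (b + c + 2) = ySer R ^ (b + c + 2) * xVar R ^ (b + c + 2) by
    rw [zSer_eq, mul_pow]]
  exact hadamard_base_aux hu1 hu2 hu3 (two_mul_halfSer h2) (halfSer_mul_uSer_mul_ySer h2)
    one_sub_tVar_sq_mul_evenSeries_one _ _

theorem coeffTX_ipk_side (h2 : IsUnit (2 : R)) (s : R) {m b c : ℕ} (hm : m = b + c + 2)
    (hsum : FormallySummable fun n => ipkPoly (Equiv.swap (⟨b, by omega⟩ : Fin m)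
      ⟨b + 1, by omega⟩) (n + 1) (PowerSeries.C (PowerSeries.C s)) (uSer R) * zSer R ^ (n + 1))
    (k j : ℕ) :
    coeffTX k j ((1 - tVar R)⁻¹ʳ + halfSer R * formalSum fun n =>
        ipkPoly (Equiv.swap (⟨b, by omega⟩ : Fin m) ⟨b + 1, by omega⟩) (n + 1)
          (PowerSeries.C (PowerSeries.C s)) (uSer R) * zSer R ^ (n + 1))
      = PowerSeries.coeff j (occSeries s b c k) := by
  -- The term `1 / (1 - t)` accounts for the empty word, counted once for every `k`.
  have hgeom : (1 - tVar R)⁻¹ʳ = PowerSeries.mk fun _ => 1 := by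
    have h1 : (PowerSeries.mk fun _ => 1) * (1 - tVar R) = 1 :=
      PowerSeries.mk_one_mul_one_sub_eq_one _
    refine isUnit_one_sub_tVar.mul_left_cancel (b := (1 - tVar R)⁻¹ʳ) ?_
    rw [Ring.mul_inverse_cancel _ isUnit_one_sub_tVar, mul_comm, h1]
  have hadd : ∀ f g : SeriesTX R, coeffTX k j (f + g) = coeffTX k j f + coeffTX k j g := by
    simp [coeffTX]
  rw [formalSum_mul_left hsum, hadd, coeffTX_formalSum, hgeom]
  have hc : ∀ n, coeffTX k j (halfSer R * (ipkPoly (Equiv.swap (⟨b, by omega⟩ : Fin m)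
      ⟨b + 1, by omega⟩) (n + 1) (PowerSeries.C (PowerSeries.C s)) (uSer R) * zSer R ^ (n + 1)))
      = if j = n + 1 then occSum s b c (2 * k) (n + 1) else 0 := fun n => by
    rw [coeffTX, coeff_halfSer_mul_ipkPoly h2 s hm, PowerSeries.coeff_C_mul,
      PowerSeries.coeff_X_pow]
    simp
  simp only [hc]
  cases j with
  | zero => simp [coeffTX, occSeries, occSum_zero]
  | succ j =>
    rw [finsum_eq_single _ j fun n hn => if_neg (by omega), if_pos rfl]
    simp [coeffTX, occSeries, PowerSeries.coeff_one]

/-- With `g = m - l`, the bound `l ≤ min (b + 1) (c + 1)` becomes `max b c < g`. -/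
theorem sum_overlap_reindex {A : Type*} [CommRing A] (z : A) (b c : ℕ) :
    ∑ l ∈ Finset.Icc 1 (min (b + 1) (c + 1)), z ^ (b + c + 2 - l)
      = ∑ g ∈ Finset.Ico (max b c + 1) (b + c + 2), z ^ g := by
  refine Finset.sum_nbij' (fun l => b + c + 2 - l) (fun g => b + c + 2 - g) ?_ ?_ ?_ ?_ ?_ <;>
    simp only [Finset.mem_Icc, Finset.mem_Ico] <;> intros <;> first | trivial | omega

theorem ipk_occ_generatingFunction (h2 : IsUnit (2 : R)) (s : R) {m b c : ℕ}
    (hm : m = b + c + 2) (hb : 1 ≤ b) (hc : 1 ≤ c) (hbc : 3 ≤ b + c) {σ : Equiv.Perm (Fin m)}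
    (hσ : σ = Equiv.swap (⟨b, by omega⟩ : Fin m) ⟨b + 1, by omega⟩) {F : SeriesTX R}
    (hF : F = 2 * tVar R * xVar R * ((1 - tVar R) ^ 2)⁻¹ʳ
      + (1 + tVar R) * (PowerSeries.C (PowerSeries.C s) - 1) * uSer R ^ 2 * zSer R ^ m
        * (2 * (1 - tVar R) * (1 - (PowerSeries.C (PowerSeries.C s) - 1) * uSer R *
          ∑ l ∈ Finset.Icc 1 (min (b + 1) (c + 1)), zSer R ^ (m - l)))⁻¹ʳ) :
    FormallySummable (fun n : ℕ =>
        ipkPoly σ (n + 1) (PowerSeries.C (PowerSeries.C s)) (uSer R) * zSer R ^ (n + 1)) ∧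
      FormallySummable (fun n : ℕ => hadamardPow F n) ∧
      (1 - tVar R)⁻¹ʳ + (1 + tVar R) * (2 * (1 - tVar R))⁻¹ʳ
          * formalSum (fun n : ℕ =>
            ipkPoly σ (n + 1) (PowerSeries.C (PowerSeries.C s)) (uSer R) * zSer R ^ (n + 1))
        = formalSum (fun n : ℕ => hadamardPow F n) := by
  have hF' : F = evenSeries (fun _ => (1 : R)) * (xVar R
        + (PowerSeries.C (PowerSeries.C s) - 1) * overlapSeries s b c) := by
    rw [hF, ← hadamard_base_eq h2, hm, sum_overlap_reindex]
  have hX : ∀ k, PowerSeries.X ∣ PowerSeries.coeff k F := by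
    refine X_dvd_coeff_of_xVar_dvd ?_
    rw [hF']
    exact (dvd_add dvd_rfl ((xVar_dvd_overlapSeries s b c).mul_left _)).mul_left _
  have hsum : FormallySummable (fun n : ℕ =>
      ipkPoly σ (n + 1) (PowerSeries.C (PowerSeries.C s)) (uSer R) * zSer R ^ (n + 1)) := by
    refine formallySummable_of_xVar_pow_dvd fun n => Dvd.dvd.mul_left ?_ _
    rw [zSer_eq, mul_pow, pow_succ (xVar R)]
    exact (dvd_mul_right _ _).mul_left _
  refine ⟨hsum, formallySummable_hadamardPow hX, ?_⟩
  subst hσ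
  refine PowerSeries.ext fun k => PowerSeries.ext fun j => ?_
  refine (coeffTX_ipk_side h2 s hm hsum k j).trans
    (coeffTX_formalSum_hadamardPow hX ?_ j).symm
  rw [hF']
  exact occSeries_mul_eq_one s k hb hc hbc

end

/-- Fractions `f / g` are written `f * g⁻¹ʳ`; every denominator that occurs is a unit of the ring of
formal power series. In the first part the ring of coefficients is `ℚ⟦s⟧`. -/
theorem theorem5p3 (m a : ℕ) (hm : 5 ≤ m) (ha : 2 ≤ a) (ham : a ≤ m - 2)
    (σ : Equiv.Perm (Fin m))
    (hσ : σ = Equiv.swap (⟨a - 1, by omega⟩ : Fin m) (⟨a, by omega⟩ : Fin m))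
    (i : ℕ) (hi : i = min a (m - a)) :
    -- (a)
    (let R := PowerSeries ℚ
      let s : SeriesTX R := PowerSeries.C (PowerSeries.C PowerSeries.X)
      let t : SeriesTX R := tVar R
      let x : SeriesTX R := xVar R
      let u : SeriesTX R := uSer R
      let z : SeriesTX R := zSer R
      let F : SeriesTX R :=
        2 * t * x * ((1 - t) ^ 2)⁻¹ʳ
          + (1 + t) * (s - 1) * u ^ 2 * z ^ m
            * (2 * (1 - t) * (1 - (s - 1) * u * ∑ l ∈ Finset.Icc 1 i, z ^ (m - l)))⁻¹ʳ
      FormallySummable (fun n : ℕ => ipkPoly σ (n + 1) s u * z ^ (n + 1)) ∧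
      FormallySummable (fun n : ℕ => hadamardPow F n) ∧
      (1 - t)⁻¹ʳ + (1 + t) * (2 * (1 - t))⁻¹ʳ
          * formalSum (fun n : ℕ => ipkPoly σ (n + 1) s u * z ^ (n + 1))
        = formalSum (fun n : ℕ => hadamardPow F n)) ∧
    -- (b)
    (let t : SeriesTX ℚ := tVar ℚ
      let x : SeriesTX ℚ := xVar ℚ
      let u : SeriesTX ℚ := uSer ℚ
      let z : SeriesTX ℚ := zSer ℚ
      let F : SeriesTX ℚ :=
        2 * t * x * ((1 - t) ^ 2)⁻¹ʳ
          - (1 + t) * u ^ 2 * z ^ m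
            * (2 * (1 - t) * (1 + u * ∑ l ∈ Finset.Icc 1 i, z ^ (m - l)))⁻¹ʳ
      FormallySummable (fun n : ℕ => ipkPolyAvoid σ (n + 1) u * z ^ (n + 1)) ∧
      FormallySummable (fun n : ℕ => hadamardPow F n) ∧
      (1 - t)⁻¹ʳ + (1 + t) * (2 * (1 - t))⁻¹ʳ
          * formalSum (fun n : ℕ => ipkPolyAvoid σ (n + 1) u * z ^ (n + 1))
        = formalSum (fun n : ℕ => hadamardPow F n)) := by
  -- Here `b` and `c` are the numbers of letters of `σ` before and after the transposed pair; `5 ≤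
  -- m` becomes `3 ≤ b + c`.
  obtain ⟨b, rfl⟩ : ∃ b, a = b + 1 := ⟨a - 1, by omega⟩
  obtain ⟨c, rfl⟩ : ∃ c, m = b + c + 2 := ⟨m - b - 2, by omega⟩
  obtain rfl : i = min (b + 1) (c + 1) := by
    rw [hi, show b + c + 2 - (b + 1) = c + 1 by omega]
  constructor
  · have h2 : IsUnit (2 : PowerSeries ℚ) := by
      have := (isUnit_iff_ne_zero.2 (two_ne_zero (α := ℚ))).map (PowerSeries.C (R := ℚ))
      rwa [map_ofNat] at this
    exact ipk_occ_generatingFunction h2 PowerSeries.X rfl (by omega) (by omega) (by omega) hσ rfl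
  -- Avoidance is the case `s = 0` over `ℚ`; the factor `s - 1` becomes `-1`, which accounts for the
  -- signs.
  · have h := ipk_occ_generatingFunction (isUnit_iff_ne_zero.2 (two_ne_zero (α := ℚ))) 0 rfl
      (by omega) (by omega) (by omega) hσ rfl
    simp only [map_zero, zero_sub, neg_mul, mul_neg, mul_one, sub_neg_eq_add, one_mul,
      ← sub_eq_add_neg] at h
    exact h
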